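/- Let $d$ be a dimension, $\mathcal T=[0,1]^d$ and $L^2(\mathcal T)$ the real Hilbert space with Lebesgue measure, inner product $\langle\cdot,\cdot\rangle_2$ and norm $\|\cdot\|_2$. Consider the functional linear model $Y=\langle\beta^*,X\rangle_2+\varepsilon$, where $\beta^*\in L^2(\mathcal T)$; $X$ is a centered, jointly measurable random function on $\mathcal T$ with $\mathbb E[X(u)^2]<\infty$ for every $u$, with paths in $L^2(\mathcal T)$, with $\|X\|_2=1$ almost surely, and with continuous covariance function $C(u,v)=\mathbb E[X(u)X(v)]$; and $\varepsilon$ is a noise with finite variance $\sigma^2$ such that $\mathbb E[\varepsilon\mid X]=0$ and $\mathbb E[\varepsilon^2\mid X]=\sigma^2$ (for instance, $\varepsilon$ centered and independent of $X$). Let $K\not\equiv 0$ be a continuous symmetric positive semi-definite kernel on $\mathcal T$, $\kappa=\max_u\sqrt{K(u,u)}$, let $L_K,L_C$ be the integral operators on $L^2(\mathcal T)$ with kernels $K$ and $C$, and $\mathscr L_K=L_C^{1/2}L_KL_C^{1/2}$. Let $(x_t,y_t)_{t\ge1}$ be independent copies of $(X,Y)$, and define $\hat\beta_1=0$ and $$\hat\beta_{t+1}=\hat\beta_t-\eta_t\big(\langle\hat\beta_t,x_t\rangle_2-y_t\big)L_Kx_t,\qquad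 t\ge1,$$ $\varphi^*=\langle\beta^*,\cdot\rangle_2$, $\hat\varphi_t=\langle\hat\beta_t,\cdot\rangle_2$, and, for a linear functional $\varphi$ on $L^2(\mathcal T)$, $\mathcal E(\varphi)=\mathbb E[(Y-\varphi(X))^2-(Y-\varphi^*(X))^2]$. Let $r>0$ and $0<s\le1$, and assume: (1) $L_C^{1/2}\beta^*=\mathscr L_K^{r}g^*$ for some $g^*\in L^2(\mathcal T)$; (2) $\mathrm{Tr}(\mathscr L_K^s)<\infty$; (3) for some $c_{\mathsf M}>0$, $\mathbb E[\langle X,f\rangle_2^4]\le c_{\mathsf M}(\mathbb E[\langle X,f\rangle_2^2])^2$ for all $f\in L^2(\mathcal T)$. Put $\eta_t=\eta_0t^{-\theta}$ with $$\theta=\frac{\min\{2r,2-s\}}{1+\min\{2r,2-s\}}=\begin{cases}\frac{2r}{2r+1},&2r\le 2-s,\\ \frac{2-s}{3-s},&2r\ge 2-s.\end{cases}$$ Then there is a constant $C_1^{\mathsf S}>0$, depending only on $r,s,c_{\mathsf M},\kappa$ and $\mathrm{Tr}(\mathscr L_K^s)$, such that whenever $0<\eta_0\le\min\{1,\kappa^{-2},C_1^{\mathsf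 S}\}$, the random variable $\mathcal E(\hat\varphi_{t+1})$ is integrable and $$\mathbb E[\mathcal E(\hat\varphi_{t+1})]\le C_1\begin{cases}(t+1)^{-\theta},&0<s<1,\\(t+1)^{-\theta}\log(t+1),&s=1,\end{cases}\qquad\text{for all }t\ge1,$$ where the constant $C_1>0$ depends only on these quantities and on $\eta_0$, $\sigma^2$, $\|\beta^*\|_2$, $\|g^*\|_2$; in particular it does not depend on $t$. -/

import Mathlib

open MeasureTheory ProbabilityTheory
open scoped unitInterval

namespace FunctionalRegression

noncomputable section

/-! ### Powers and traces of compact positive operators on a real Hilbert space -/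

section Operators

variable {E : Type*} [NormedAddCommGroup E] [InnerProductSpace ℝ E] [CompleteSpace E]

/-- The `μ`-eigenspace of a bounded operator. -/
abbrev eigSpace (A : E →L[ℝ] E) (μ : ℝ) : Submodule ℝ E :=
  Module.End.eigenspace (A : E →ₗ[ℝ] E) μ

instance completeSpace_eigSpace (A : E →L[ℝ] E) (μ : ℝ) : CompleteSpace (eigSpace A μ) := by
  have h : IsClosed ((eigSpace A μ : Submodule ℝ E) : Set E) := by
    have : ((eigSpace A μ : Submodule ℝ E) : Set E) = {x | A x = μ • x} := by
      ext x; simp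
    rw [this]
    exact isClosed_eq A.continuous (continuous_const.smul continuous_id)
  exact h.completeSpace_coe

/-- The orthogonal projection onto the `μ`-eigenspace (zero if `μ` is not an eigenvalue). -/
def eigProj (A : E →L[ℝ] E) (μ : ℝ) : E →L[ℝ] E := (eigSpace A μ).starProjection

lemma apply_eigProj (A : E →L[ℝ] E) (μ : ℝ) (f : E) : A (eigProj A μ f) = μ • eigProj A μ f := by
  have : eigProj A μ f ∈ eigSpace A μ := Submodule.starProjection_apply_mem _ _
  simpa using this

lemma sum_eigProj_sq (A : E →L[ℝ] E) (hA : A.IsPositive) (c : ℝ → ℝ) (f : E) (s : Finset ℝ) :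
    ‖∑ μ ∈ s, c μ • eigProj A μ f‖ ^ 2 = ∑ μ ∈ s, c μ ^ 2 * ‖eigProj A μ f‖ ^ 2 := by
  have h := (hA.1.orthogonalFamily_eigenspaces).norm_sum
    (fun μ => c μ • (eigSpace A μ).orthogonalProjectionOnto f) s
  simpa [eigProj, norm_smul, mul_pow] using h

lemma bessel_eigProj (A : E →L[ℝ] E) (hA : A.IsPositive) (f : E) (s : Finset ℝ) :
    ∑ μ ∈ s, ‖eigProj A μ f‖ ^ 2 ≤ ‖f‖ ^ 2 := by
  have h1 := sum_eigProj_sq A hA (fun _ => 1) f s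
  simp only [one_smul, one_pow, one_mul] at h1
  have h2 : inner ℝ (∑ μ ∈ s, eigProj A μ f) f = ∑ μ ∈ s, ‖eigProj A μ f‖ ^ 2 := by
    rw [sum_inner]
    refine Finset.sum_congr rfl fun μ _ => ?_
    have h3 := Submodule.starProjection_inner_eq_zero (K := eigSpace A μ) f
      (eigProj A μ f) (Submodule.starProjection_apply_mem _ _)
    rw [inner_sub_left, sub_eq_zero] at h3
    rw [real_inner_comm, h3]
    exact real_inner_self_eq_norm_sq _
  have h4 := real_inner_le_norm (∑ μ ∈ s, eigProj A μ f) f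
  rw [h2, ← h1] at h4
  rw [← h1]
  have h5 := norm_nonneg (∑ μ ∈ s, eigProj A μ f)
  have h6 := norm_nonneg f
  nlinarith [sq_nonneg (‖∑ μ ∈ s, eigProj A μ f‖ - ‖f‖)]

lemma eigProj_coeff_le (A : E →L[ℝ] E) (hA : A.IsPositive) {r : ℝ} (hr : 0 ≤ r) (μ : ℝ) (f : E) :
    (μ ^ r) ^ 2 * ‖eigProj A μ f‖ ^ 2 ≤ (‖A‖ ^ r) ^ 2 * ‖eigProj A μ f‖ ^ 2 := by
  by_cases h0 : eigProj A μ f = 0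
  · simp [h0]
  have hp : 0 < ‖eigProj A μ f‖ := norm_pos_iff.2 h0
  have e := apply_eigProj A μ f
  have hμ0 : 0 ≤ μ := by
    have h := hA.2 (eigProj A μ f)
    rw [ContinuousLinearMap.reApplyInnerSelf_apply, e, inner_smul_left,
      real_inner_self_eq_norm_sq] at h
    simp only [conj_trivial, RCLike.re_to_real] at h
    exact nonneg_of_mul_nonneg_left h (by positivity)
  have hμ1 : μ ≤ ‖A‖ := by
    have h := A.le_opNorm (eigProj A μ f)
    rw [e, norm_smul, Real.norm_of_nonneg hμ0] at h
    exact le_of_mul_le_mul_right h hp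
  have := Real.rpow_le_rpow hμ0 hμ1 hr
  have h7 := Real.rpow_nonneg hμ0 r
  gcongr

lemma sum_opPow_le (A : E →L[ℝ] E) (hA : A.IsPositive) {r : ℝ} (hr : 0 ≤ r) (f : E)
    (s : Finset ℝ) : ‖∑ μ ∈ s, μ ^ r • eigProj A μ f‖ ≤ ‖A‖ ^ r * ‖f‖ := by
  refine le_of_sq_le_sq ?_ (by positivity)
  rw [sum_eigProj_sq A hA (fun μ => μ ^ r) f s, mul_pow]
  calc _ ≤ ∑ μ ∈ s, (‖A‖ ^ r) ^ 2 * ‖eigProj A μ f‖ ^ 2 :=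
        Finset.sum_le_sum fun μ _ => eigProj_coeff_le A hA hr μ f
    _ = (‖A‖ ^ r) ^ 2 * ∑ μ ∈ s, ‖eigProj A μ f‖ ^ 2 := by rw [Finset.mul_sum]
    _ ≤ _ := by gcongr; exact bessel_eigProj A hA f s

lemma summable_opPow (A : E →L[ℝ] E) (hA : A.IsPositive) {r : ℝ} (hr : 0 ≤ r) (f : E) :
    Summable fun μ : ℝ => μ ^ r • eigProj A μ f := by
  have h := (hA.1.orthogonalFamily_eigenspaces).summable_iff_norm_sq_summable
    (fun μ => μ ^ r • (eigSpace A μ).orthogonalProjectionOnto f)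
  have h' : Summable fun μ : ℝ => ‖μ ^ r • (eigSpace A μ).orthogonalProjectionOnto f‖ ^ 2 := by
    refine summable_of_sum_le (c := (‖A‖ ^ r * ‖f‖) ^ 2) (fun _ => by positivity) fun s => ?_
    have h1 := sum_eigProj_sq A hA (fun μ => μ ^ r) f s
    have h2 := sum_opPow_le A hA hr f s
    have h3 : ∑ μ ∈ s, ‖μ ^ r • (eigSpace A μ).orthogonalProjectionOnto f‖ ^ 2
        = ∑ μ ∈ s, (μ ^ r) ^ 2 * ‖eigProj A μ f‖ ^ 2 := by
      refine Finset.sum_congr rfl fun μ _ => ?_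
      simp [eigProj, norm_smul, mul_pow]
    rw [h3, ← h1]
    gcongr
  simpa [eigProj] using h.2 h'

open Classical in
/-- The power `A ^ r`, `r ≥ 0`, of a compact positive semi-definite operator through the spectral
theorem: `A ^ r f = ∑ μ, μ ^ r P_μ f`, the sum being over the eigenvalues `μ` of `A` and `P_μ` the
orthogonal projection onto the eigenspace of `μ` (terms with `μ` not an eigenvalue vanish). -/
def opPow (A : E →L[ℝ] E) (r : ℝ) : E →L[ℝ] E :=
  if h : A.IsPositive ∧ 0 ≤ r then
    LinearMap.mkContinuous
      { toFun := fun f => ∑' μ : ℝ, μ ^ r • eigProj A μ f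
        map_add' := fun f g => by
          simp only [map_add, smul_add]
          exact (summable_opPow A h.1 h.2 f).tsum_add (summable_opPow A h.1 h.2 g)
        map_smul' := fun c f => by
          simp only [map_smul, RingHom.id_apply]
          rw [← (summable_opPow A h.1 h.2 f).tsum_const_smul c]
          simp only [smul_comm c] }
      (‖A‖ ^ r) fun f =>
        le_of_tendsto ((summable_opPow A h.1 h.2 f).hasSum.norm)
          (Filter.Eventually.of_forall fun s => sum_opPow_le A h.1 h.2 f s)
  else 0

/-- The trace of a compact positive semi-definite operator: the sum of its positive eigenvalues,
counted with multiplicity, as an element of `[0, ∞]`. -/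
def opTrace (A : E →L[ℝ] E) : ENNReal :=
  ∑' μ : Set.Ioi (0 : ℝ),
    ENNReal.ofReal (μ : ℝ) * ((Cardinal.toENat (Module.rank ℝ (eigSpace A μ)) : ℕ∞) : ENNReal)

end Operators

/-! ### The cube, `L²` and integral operators -/

/-- The domain `𝒯 = [0,1]^d`; its `volume` is Lebesgue measure. -/
abbrev Cube (d : ℕ) : Type := Fin d → I

/-- The real Hilbert space `L²(𝒯)`. -/
abbrev L2 (d : ℕ) : Type := Lp ℝ 2 (volume : Measure (Cube d))

instance (d : ℕ) : MeasurableSpace (L2 d) := borel _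

instance (d : ℕ) : BorelSpace (L2 d) := ⟨rfl⟩

/-- The continuous map `x ↦ k(x, ·)` into `L²(𝒯)`. -/
def kernelSection {d : ℕ} (k : C(Cube d × Cube d, ℝ)) : C(Cube d, L2 d) :=
  ⟨fun x => ContinuousMap.toLp 2 volume ℝ (k.curry x),
    (ContinuousMap.toLp 2 volume ℝ).continuous.comp k.curry.continuous⟩

lemma integral_kernel_eq_inner {d : ℕ} (k : C(Cube d × Cube d, ℝ)) (f : L2 d) (x : Cube d) :
    ∫ u, k (x, u) * f u = inner ℝ (kernelSection k x) f := by
  rw [L2.inner_def]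
  refine integral_congr_ae ?_
  filter_upwards [ContinuousMap.coeFn_toLp (p := 2) (𝕜 := ℝ) volume (k.curry x)] with u hu
  simp only [kernelSection, ContinuousMap.coe_mk, hu, ContinuousMap.curry_apply, RCLike.inner_apply,
    conj_trivial]
  ring

/-- The integral operator `(L f)(x) = ∫ k(x, u) f(u) du` on `L²(𝒯)` with continuous kernel `k`. -/
def integralOp {d : ℕ} (k : C(Cube d × Cube d, ℝ)) : L2 d →L[ℝ] L2 d :=
  (ContinuousMap.toLp 2 volume ℝ).comp <|
    LinearMap.mkContinuous
      ({
        toFun := fun f => (⟨fun x => ∫ u, k (x, u) * f u, by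
          simp only [integral_kernel_eq_inner]
          exact (kernelSection k).continuous.inner continuous_const⟩ : C(Cube d, ℝ))
        map_add' := fun f g => by
          ext x
          simp only [ContinuousMap.coe_mk, ContinuousMap.add_apply, integral_kernel_eq_inner,
            inner_add_right]
        map_smul' := fun c f => by
          ext x
          simp only [ContinuousMap.coe_mk, ContinuousMap.smul_apply, integral_kernel_eq_inner,
            inner_smul_right, RingHom.id_apply, smul_eq_mul] } : L2 d →ₗ[ℝ] C(Cube d, ℝ))
      ‖kernelSection k‖ fun f => by
        refine (ContinuousMap.norm_le _ (by positivity)).2 fun x => ?_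
        simp only [LinearMap.coe_mk, AddHom.coe_mk, ContinuousMap.coe_mk, integral_kernel_eq_inner]
        exact (norm_inner_le_norm _ _).trans
          (mul_le_mul_of_nonneg_right ((kernelSection k).norm_coe_le_norm x) (norm_nonneg _))

/-- A continuous, symmetric, positive semi-definite kernel on `𝒯` that is not identically zero. -/
structure ReproducingKernel (d : ℕ) where
  toMap : C(Cube d × Cube d, ℝ)
  symm : ∀ u v, toMap (u, v) = toMap (v, u)
  posSemidef : ∀ (n : ℕ) (u : Fin n → Cube d),
    (Matrix.of fun i j => toMap (u i, u j)).PosSemidef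
  ne_zero : toMap ≠ 0

namespace ReproducingKernel

variable {d : ℕ} (K : ReproducingKernel d)

/-- `κ = max_u √K(u,u)`. -/
def kappa : ℝ := ⨆ u : Cube d, √(K.toMap (u, u))

/-- The integral operator `L_K`. -/
def op : L2 d →L[ℝ] L2 d := integralOp K.toMap

end ReproducingKernel

/-! ### The functional linear model -/

/-- The functional linear model `Y = ∫ β⋆(u) X(u) du + ε` on `𝒯 = [0,1]^d`, with `X` a centered
second order random function with square integrable paths, `‖X‖₂ = 1` almost surely and continuous
covariance function, and with a square integrable noise `ε` that, given `X`, has mean zero and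
variance `σ² = Var(ε)` (as when `ε` is centered and independent of `X`). -/
structure FunctionalLinearModel (d : ℕ) {Ω : Type*} [MeasurableSpace Ω] (P : Measure Ω) where
  /-- the slope function -/
  slope : L2 d
  /-- the random function -/
  process : Ω → Cube d → ℝ
  /-- the noise -/
  noise : Ω → ℝ
  measurable_process : Measurable (Function.uncurry process)
  memLp_path : ∀ ω, MemLp (process ω) 2 volume
  memLp_eval : ∀ u, MemLp (fun ω => process ω u) 2 P
  mean_process : ∀ u, ∫ ω, process ω u ∂P = 0
  norm_process : ∀ᵐ ω ∂P, ‖(memLp_path ω).toLp (process ω)‖ = 1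
  continuous_cov : Continuous fun p : Cube d × Cube d => ∫ ω, process ω p.1 * process ω p.2 ∂P
  memLp_noise : MemLp noise 2 P
  condMean_noise :
    P[noise | MeasurableSpace.comap (fun ω => (memLp_path ω).toLp (process ω)) inferInstance]
      =ᵐ[P] fun _ => 0
  condVar_noise :
    P[fun ω => noise ω ^ 2 |
        MeasurableSpace.comap (fun ω => (memLp_path ω).toLp (process ω)) inferInstance]
      =ᵐ[P] fun _ => Var[noise; P]

namespace FunctionalLinearModel

variable {d : ℕ} {Ω : Type*} [MeasurableSpace Ω] {P : Measure Ω} (M : FunctionalLinearModel d P)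

/-- The random function as a random element of `L²(𝒯)`. -/
def X (ω : Ω) : L2 d := (M.memLp_path ω).toLp (M.process ω)

/-- The response `Y = ⟨β⋆, X⟩ + ε`. -/
def Y (ω : Ω) : ℝ := inner ℝ M.slope (M.X ω) + M.noise ω

/-- The covariance function `C(u,v) = E[X(u) X(v)]`. -/
def cov : C(Cube d × Cube d, ℝ) :=
  ⟨fun p => ∫ ω, M.process ω p.1 * M.process ω p.2 ∂P, M.continuous_cov⟩

/-- The covariance operator `L_C`. -/
def covOp : L2 d →L[ℝ] L2 d := integralOp M.cov

/-- The operator `L_C^{1/2} L_K L_C^{1/2}`. -/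
def mixedOp (K : ReproducingKernel d) : L2 d →L[ℝ] L2 d :=
  opPow M.covOp (1 / 2) ∘L K.op ∘L opPow M.covOp (1 / 2)

/-- The excess generalization error `E[(Y - φ(X))² - (Y - φ⋆(X))²]` of a functional `φ` on
`L²(𝒯)`, where `φ⋆ = ⟨β⋆, ·⟩`. -/
def excessError (φ : L2 d → ℝ) : ℝ :=
  ∫ ω, ((M.Y ω - φ (M.X ω)) ^ 2 - (M.Y ω - inner ℝ M.slope (M.X ω)) ^ 2) ∂P

/-- Regularity of the slope: `L_C^{1/2} β⋆ = (L_C^{1/2} L_K L_C^{1/2})^r g`. -/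
def Regularity (K : ReproducingKernel d) (r : ℝ) (g : L2 d) : Prop :=
  opPow M.covOp (1 / 2) M.slope = opPow (M.mixedOp K) r g

/-- The fourth moment condition `E⟨X,f⟩⁴ ≤ c (E⟨X,f⟩²)²` for all `f ∈ L²(𝒯)`. -/
def MomentCondition (c : ℝ) : Prop :=
  ∀ f : L2 d, ∫ ω, inner ℝ (M.X ω) f ^ 4 ∂P ≤ c * (∫ ω, inner ℝ (M.X ω) f ^ 2 ∂P) ^ 2

/-- `(x_t, y_t)`, `t ≥ 1`, are independent copies of `(X, Y)`. -/
def IsSample {Ω' : Type*} [MeasurableSpace Ω'] (P' : Measure Ω')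
    (x : ℕ → Ω' → L2 d) (y : ℕ → Ω' → ℝ) : Prop :=
  iIndepFun (fun (n : ℕ) (ω : Ω') => (x (n + 1) ω, y (n + 1) ω)) P' ∧
    ∀ t : ℕ, 1 ≤ t →
      IdentDistrib (fun ω => (x t ω, y t ω)) (fun ω => (M.X ω, M.Y ω)) P' P

end FunctionalLinearModel

/-- The iterates of stochastic gradient descent: `β̂₁ = 0` and
`β̂_{t+1} = β̂_t - η_t (⟨β̂_t, x_t⟩ - y_t) L_K x_t` for `t ≥ 1` (the index `0` is not used). -/
def sgd {d : ℕ} (K : ReproducingKernel d) (η : ℕ → ℝ) (x : ℕ → L2 d) (y : ℕ → ℝ) : ℕ → L2 d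
  | 0 => 0
  | 1 => 0
  | t + 2 => sgd K η x y (t + 1) -
      (η (t + 1) * (inner ℝ (sgd K η x y (t + 1)) (x (t + 1)) - y (t + 1))) • K.op (x (t + 1))

/-- The exponent `θ = min{2r, 2-s} / (1 + min{2r, 2-s})`. -/
def rateExponent (r s : ℝ) : ℝ := min (2 * r) (2 - s) / (1 + min (2 * r) (2 - s))

end

end FunctionalRegression

open FunctionalRegression

open FunctionalRegression

/-! Since the noise has conditional mean zero, the excess error of `⟨β, ·⟩` is `‖L_C^{1/2}(β -
β⋆)‖²` (`excessError_inner`), so everything reduces to the second moments of `F_n =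
L_C^{1/2}(β̂_{n+1} - β⋆)`. These are studied coordinatewise in an orthonormal eigenbasis `φ_i` of
`L_C^{1/2} L_K L_C^{1/2}`, with eigenvalues `ev_i`. By independence of the new sample, the expected
gradient step multiplies `⟨F_n, φ_i⟩` by `1 - η ev_i`, while the fourth moment condition bounds the
fluctuation by `η² ev_i² (c E‖F_n‖² + σ²)` (`integral_coord_sq_succ_le`). The coordinates are thus
coupled only through the total error.

Unrolling with `1 - x ≤ e^{-x}` leaves factors `exp(-2 η₀ ev S)`, where `S` is a partial sum of
`k^{-θ}`, and `ev^p exp(-2 η₀ ev S)` is at most a constant times `(η₀ (1 + S))^{-p}`. For the bias,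
`p = 2r`: the source condition gives initial coordinates `ev^r ⟨g, φ_i⟩`, and Bessel sums them. For
the noise, `p = 2 - s`: of `ev²`, the part `ev^s` is kept and summed by the trace. This yields a
discrete Volterra inequality for `E‖F_n‖²` (`integral_norm_sq_le`), whose feedback coefficient is
proportional to `η₀^s`. For small `η₀` the errors are therefore bounded, and inserting this bound
once more gives decay (`le_of_weak_feedback`).

It remains to estimate the noise weights (`exists_noiseWeight_le`). As `S` over the first `n` steps
is at least `n^{1-θ}`, the bias is of order `n^{-2r(1-θ)}`; recent noise contributes `n^{-θ}`, and
old noise is damped by `n^{-(2-s)(1-θ)}`. The exponent `θ` solves `θ = (1-θ) min(2r, 2-s)`; at `s =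
1` the integral of `(1+t)^{-(2-s)}` diverges logarithmically, whence the extra logarithm. -/

namespace FunctionalRegression

/-! ### Spectral calculus of compact positive operators. -/

section Operators

universe u

variable {E : Type u} [NormedAddCommGroup E] [InnerProductSpace ℝ E] [CompleteSpace E]

lemma eigProj_apply_self {A : E →L[ℝ] E} {μ : ℝ} {f : E} (hf : A f = μ • f) :
    eigProj A μ f = f :=
  Submodule.starProjection_eq_self_iff.2 (by simpa using hf)

lemma eigProj_apply_of_ne {A : E →L[ℝ] E} (hA : A.IsPositive) {μ ν : ℝ} (h : ν ≠ μ) {f : E}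
    (hf : A f = μ • f) : eigProj A ν f = 0 := by
  have hm : f ∈ eigSpace A μ := by simpa using hf
  refine (Submodule.starProjection_apply_eq_zero_iff (K := eigSpace A ν)).2 ?_
  intro g hg
  exact (hA.1.orthogonalFamily_eigenspaces).isOrtho h.symm hm g hg

lemma opPow_apply {A : E →L[ℝ] E} (hA : A.IsPositive) {r : ℝ} (hr : 0 ≤ r) (f : E) :
    opPow A r f = ∑' μ : ℝ, μ ^ r • eigProj A μ f := by
  rw [opPow, dif_pos ⟨hA, hr⟩]; rfl

lemma opPow_apply_eigenvector {A : E →L[ℝ] E} (hA : A.IsPositive) {r : ℝ} (hr : 0 ≤ r) {μ : ℝ}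
    {f : E} (hf : A f = μ • f) : opPow A r f = μ ^ r • f := by
  rw [opPow_apply hA hr, tsum_eq_single μ, eigProj_apply_self hf]
  intro ν hν
  rw [eigProj_apply_of_ne hA hν hf, smul_zero]

lemma norm_opPow_le {A : E →L[ℝ] E} (hA : A.IsPositive) {r : ℝ} (hr : 0 ≤ r) :
    ‖opPow A r‖ ≤ ‖A‖ ^ r := by
  rw [opPow, dif_pos ⟨hA, hr⟩]
  exact LinearMap.mkContinuous_norm_le _ (by positivity) _

lemma inner_opPow_left {A : E →L[ℝ] E} (hA : A.IsPositive) {r : ℝ} (hr : 0 ≤ r) (f g : E) :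
    inner ℝ (opPow A r f) g = inner ℝ f (opPow A r g) := by
  have h1 := (summable_opPow A hA hr f).hasSum.mapL (innerSL ℝ g)
  have h2 := (summable_opPow A hA hr g).hasSum.mapL (innerSL ℝ f)
  rw [← opPow_apply hA hr] at h1 h2
  simp only [innerSL_apply_apply] at h1 h2
  rw [real_inner_comm]
  refine h1.unique ?_
  convert h2 using 2 with μ
  rw [inner_smul_right, inner_smul_right]
  congr 1
  rw [real_inner_comm]
  exact Submodule.inner_starProjection_left_eq_right _ _ _

omit [CompleteSpace E] in
lemma IsPositive.eigenvalue_nonneg {A : E →L[ℝ] E} (hA : A.IsPositive) {μ : ℝ} {f : E}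
    (hf : A f = μ • f) (h0 : f ≠ 0) : 0 ≤ μ := by
  have h := hA.2 f
  rw [ContinuousLinearMap.reApplyInnerSelf_apply, hf, inner_smul_left,
    real_inner_self_eq_norm_sq] at h
  simp only [conj_trivial, RCLike.re_to_real] at h
  exact nonneg_of_mul_nonneg_left h (by positivity)

-- An eigenspace may be infinite dimensional (the kernel, for instance), so its basis is a Hilbert
-- basis and orthogonality passes to the whole space by continuity rather than by finite
-- combinations.
omit [CompleteSpace E] in
lemma inner_eq_zero_of_forall_hilbertBasis {V : Submodule ℝ E} {ι : Type*} (b : HilbertBasis ι ℝ V)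
    {x : E} (hx : ∀ i, inner ℝ x (b i : E) = 0) {y : E} (hy : y ∈ V) : inner ℝ x y = 0 := by
  have hs := (b.hasSum_repr ⟨y, hy⟩).mapL ((innerSL ℝ x).comp V.subtypeL)
  have h0 : ∀ i, ((innerSL ℝ x).comp V.subtypeL) (b.repr ⟨y, hy⟩ i • b i) = 0 := fun i => by
    rw [map_smul]
    simp [hx i]
  simp only [h0] at hs
  simpa using hs.unique hasSum_zero

/-- A compact positive operator has a Hilbert basis of eigenvectors. -/
lemma exists_hilbertBasis_eigenvectors {A : E →L[ℝ] E} (hA : A.IsPositive)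
    (hc : IsCompactOperator A) :
    ∃ (ι : Type u) (b : HilbertBasis ι ℝ E) (ev : ι → ℝ), ∀ i, A (b i) = ev i • b i := by
  choose w b hb using fun μ : ℝ => exists_hilbertBasis ℝ (eigSpace A μ)
  have hon : Orthonormal ℝ (fun i : Σ μ, w μ => ((b i.1 i.2 : eigSpace A i.1) : E)) :=
    (hA.1.orthogonalFamily_eigenspaces).orthonormal_sigma_orthonormal
      (v_family := fun μ => ⇑(b μ)) (fun μ => (b μ).orthonormal)
  have hbot : (Submodule.span ℝ (Set.range
      (fun i : Σ μ, w μ => ((b i.1 i.2 : eigSpace A i.1) : E))))ᗮ = ⊥ := by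
    rw [eq_bot_iff]
    intro x hx
    -- Compactness enters here: the eigenspaces together have trivial orthogonal complement, so it
    -- suffices that `x` is orthogonal to each of them.
    rw [← ContinuousLinearMap.orthogonalComplement_iSup_eigenspaces_eq_bot hc hA.1]
    rw [Submodule.mem_orthogonal] at hx ⊢
    have hle : (⨆ μ, Module.End.eigenspace (A : E →ₗ[ℝ] E) μ) ≤ (Submodule.span ℝ {x})ᗮ := by
      refine iSup_le fun μ y hy => ?_
      rw [Submodule.mem_orthogonal_singleton_iff_inner_right]
      refine inner_eq_zero_of_forall_hilbertBasis (b μ) (fun i => ?_) hy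
      rw [real_inner_comm]
      exact hx (b μ i) (Submodule.subset_span ⟨⟨μ, i⟩, rfl⟩)
    intro y hy
    exact (Submodule.mem_orthogonal_singleton_iff_inner_left).1 (hle hy)
  refine ⟨Σ μ, w μ, HilbertBasis.mkOfOrthogonalEqBot hon hbot, fun i => i.1, fun i => ?_⟩
  rw [HilbertBasis.coe_mkOfOrthogonalEqBot]
  exact Module.End.mem_eigenspace_iff.1 (b i.1 i.2).2

/-- `opPow` only sees eigenvectors, so compactness is essential: both sides are continuous and agree
on an eigenbasis, whose span is dense. -/
lemma opPow_half_apply_opPow_half {A : E →L[ℝ] E} (hA : A.IsPositive) (hc : IsCompactOperator A)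
    (f : E) : opPow A (1 / 2) (opPow A (1 / 2) f) = A f := by
  obtain ⟨ι, b, ev, hb⟩ := exists_hilbertBasis_eigenvectors hA hc
  have : opPow A (1 / 2) ∘L opPow A (1 / 2) = A := by
    refine ContinuousLinearMap.ext_on (s := Set.range b)
      (Submodule.dense_iff_topologicalClosure_eq_top.2 b.dense_span) ?_
    rintro _ ⟨i, rfl⟩
    have h0 : 0 ≤ ev i := IsPositive.eigenvalue_nonneg hA (hb i) (b.orthonormal.ne_zero i)
    rw [ContinuousLinearMap.comp_apply, opPow_apply_eigenvector hA (by norm_num) (hb i), map_smul,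
      opPow_apply_eigenvector hA (by norm_num) (hb i), smul_smul, ← Real.sqrt_eq_rpow,
      Real.mul_self_sqrt h0, hb i]
  exact congrArg (fun T : E →L[ℝ] E => T f) this

-- Group the basis vectors by the value of `ev i ^ s`. Those sharing a value `μ` are independent
-- vectors in the `μ`-eigenspace of `A ^ s`, so their number is at most its dimension. Only this
-- inequality is needed.
open Classical in
lemma tsum_rpow_le_opTrace {A : E →L[ℝ] E} (hA : A.IsPositive) {ι : Type*}
    (b : HilbertBasis ι ℝ E) {ev : ι → ℝ} (hb : ∀ i, A (b i) = ev i • b i) {s : ℝ} (hs : 0 < s) :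
    ∑' i, ENNReal.ofReal (ev i ^ s) ≤ opTrace (opPow A s) := by
  have h0 : ∀ i, 0 ≤ ev i := fun i =>
    IsPositive.eigenvalue_nonneg hA (hb i) (b.orthonormal.ne_zero i)
  have hfib : ∑' i, ENNReal.ofReal (ev i ^ s)
      = ∑' μ : ℝ, ENNReal.ofReal μ * (ENat.card {i // ev i ^ s = μ} : ENNReal) := by
    rw [← (Equiv.sigmaFiberEquiv fun i => ev i ^ s).tsum_eq, ENNReal.tsum_sigma']
    refine tsum_congr fun μ => ?_
    have : ∀ i : {i // ev i ^ s = μ}, ENNReal.ofReal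
        (ev ((Equiv.sigmaFiberEquiv fun i => ev i ^ s) ⟨μ, i⟩) ^ s) = ENNReal.ofReal μ := by
      rintro ⟨i, rfl⟩; rfl
    rw [tsum_congr this, ENNReal.tsum_const, mul_comm]
  rw [hfib, opTrace, ← tsum_subtype_eq_of_support_subset (s := Set.Ioi (0 : ℝ))]
  · refine ENNReal.tsum_le_tsum fun μ => ?_
    gcongr
    let v : {i // ev i ^ s = (μ : ℝ)} → eigSpace (opPow A s) μ := fun i => ⟨b i, by
      have := opPow_apply_eigenvector hA hs.le (hb i)
      rw [i.2] at this
      simpa using this⟩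
    have hv : LinearIndependent ℝ v := by
      refine LinearIndependent.of_comp (eigSpace (opPow A s) μ).subtype ?_
      exact b.orthonormal.linearIndependent.comp (fun i : {i // ev i ^ s = (μ : ℝ)} => (i : ι))
        Subtype.val_injective
    have := hv.cardinal_lift_le_rank
    have h2 := Cardinal.toENat.monotone' this
    simpa [ENat.card] using h2
  · intro μ hμ
    by_contra hn
    exact hμ (by simp [ENNReal.ofReal_of_nonpos (not_lt.1 hn)])

end Operators

/-! ### Integral operators with continuous kernels: compactness, positivity, norm. -/

section Kernels

variable {d : ℕ}

/-- The continuous representative of `integralOp k f`. -/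
noncomputable def integralRep (k : C(Cube d × Cube d, ℝ)) (f : L2 d) : C(Cube d, ℝ) :=
  ⟨fun x => inner ℝ (kernelSection k x) f, (kernelSection k).continuous.inner continuous_const⟩

lemma integralOp_eq_toLp (k : C(Cube d × Cube d, ℝ)) (f : L2 d) :
    integralOp k f = ContinuousMap.toLp 2 volume ℝ (integralRep k f) := by
  have : integralRep k f = ⟨fun x => ∫ u, k (x, u) * f u, by
      simp only [integral_kernel_eq_inner]
      exact (kernelSection k).continuous.inner continuous_const⟩ := by
    ext x
    simp [integralRep, integral_kernel_eq_inner]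
  rw [this]
  rfl

lemma coeFn_integralOp (k : C(Cube d × Cube d, ℝ)) (f : L2 d) :
    integralOp k f =ᵐ[volume] fun x => ∫ u, k (x, u) * f u := by
  rw [integralOp_eq_toLp]
  filter_upwards [ContinuousMap.coeFn_toLp (p := 2) (𝕜 := ℝ) volume (integralRep k f)] with x hx
  rw [hx, integral_kernel_eq_inner]
  rfl

lemma inner_integralOp (k : C(Cube d × Cube d, ℝ)) (f g : L2 d) :
    inner ℝ (integralOp k f) g = ∫ x, (∫ u, k (x, u) * f u) * g x := by
  rw [L2.inner_def]
  refine integral_congr_ae ?_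
  filter_upwards [coeFn_integralOp k f] with x hx
  simp only [hx, RCLike.inner_apply, conj_trivial]
  ring

/-- Arzelà–Ascoli: since `x ↦ k(x, ·)` is continuous into `L²`, the image of the unit ball is
bounded and equicontinuous in the space of continuous functions, which maps continuously into `L²`.
-/
lemma isCompactOperator_integralOp (k : C(Cube d × Cube d, ℝ)) :
    IsCompactOperator (integralOp k) := by
  let e : BoundedContinuousFunction (Cube d) ℝ ≃ᵢ C(Cube d, ℝ) :=
    (ContinuousMap.isometryEquivBoundedOfCompact (Cube d) ℝ).symm
  let A : Set (BoundedContinuousFunction (Cube d) ℝ) :=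
    {F | ∃ f ∈ Metric.closedBall (0 : L2 d) 1, ∀ x, F x = inner ℝ (kernelSection k x) f}
  have hA : IsCompact (closure A) := by
    refine BoundedContinuousFunction.arzela_ascoli (Metric.closedBall (0 : ℝ) ‖kernelSection k‖)
      (isCompact_closedBall _ _) A ?_ ?_
    · rintro F x ⟨f, hf, hF⟩
      rw [mem_closedBall_zero_iff] at hf ⊢
      rw [hF]
      calc _ ≤ ‖kernelSection k x‖ * ‖f‖ := norm_inner_le_norm _ _
        _ ≤ ‖kernelSection k‖ * 1 := by
          gcongr
          exact (kernelSection k).norm_coe_le_norm x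
        _ = _ := mul_one _
    · intro x₀
      rw [Metric.equicontinuousAt_iff]
      intro ε hε
      obtain ⟨δ, hδ, h⟩ := Metric.continuousAt_iff.1 (kernelSection k).continuous.continuousAt ε hε
      refine ⟨δ, hδ, fun x hx ⟨F, f, hf, hF⟩ => ?_⟩
      rw [mem_closedBall_zero_iff] at hf
      change dist (F x₀) (F x) < ε
      rw [hF, hF, Real.dist_eq, ← inner_sub_left]
      calc _ ≤ ‖kernelSection k x₀ - kernelSection k x‖ * ‖f‖ := abs_real_inner_le_norm _ _
        _ ≤ ‖kernelSection k x₀ - kernelSection k x‖ * 1 := by gcongr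
        _ = dist (kernelSection k x) (kernelSection k x₀) := by
          rw [mul_one, dist_comm, dist_eq_norm]
        _ < ε := h hx
  refine (isCompactOperator_iff_image_closedBall_subset_compact (𝕜₁ := ℝ)
    (integralOp k : L2 d →ₗ[ℝ] L2 d) one_pos).2
    ⟨(fun F => ContinuousMap.toLp (E := ℝ) 2 volume ℝ (e F)) '' closure A, hA.image
      ((ContinuousMap.toLp 2 volume ℝ).continuous.comp e.continuous), ?_⟩
  rintro _ ⟨f, hf, rfl⟩
  refine ⟨e.symm (integralRep k f), subset_closure ⟨f, hf, fun x => rfl⟩, ?_⟩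
  simp only [IsometryEquiv.apply_symm_apply]
  exact (integralOp_eq_toLp k f).symm

lemma integrable_L2 (f : L2 d) : Integrable f (volume : Measure (Cube d)) :=
  (Lp.memLp f).integrable (by norm_num)

lemma integral_norm_le_norm (f : L2 d) : ∫ u, ‖f u‖ ≤ ‖f‖ := by
  rw [integral_norm_eq_lintegral_enorm (Lp.aestronglyMeasurable f), ← eLpNorm_one_eq_lintegral_enorm,
    Lp.norm_def]
  exact ENNReal.toReal_mono (Lp.eLpNorm_ne_top f)
    (eLpNorm_le_eLpNorm_of_exponent_le (by norm_num) (Lp.aestronglyMeasurable f))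

section FeatureMap

variable {H : Type*} [NormedAddCommGroup H] [InnerProductSpace ℝ H] [CompleteSpace H]

omit [CompleteSpace H] in
lemma integrable_smul_featureMap (Φ : C(Cube d, H)) (f : L2 d) :
    Integrable fun u => f u • Φ u :=
  (integrable_L2 f).smul_bdd ‖Φ‖ Φ.continuous.stronglyMeasurable.aestronglyMeasurable
    (Filter.Eventually.of_forall Φ.norm_coe_le_norm)

/-- A feature map factors the operator as `S* S` with `S f = ∫ f Φ`; symmetry, positivity and the
bound `κ²` for `L_K` then follow at once. -/
lemma inner_integralOp_featureMap {k : C(Cube d × Cube d, ℝ)} (Φ : C(Cube d, H))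
    (hΦ : ∀ x u, k (x, u) = inner ℝ (Φ x) (Φ u)) (f g : L2 d) :
    inner ℝ (integralOp k f) g = inner ℝ (∫ u, f u • Φ u) (∫ u, g u • Φ u) := by
  have h1 : ∀ x, ∫ u, k (x, u) * f u = inner ℝ (Φ x) (∫ u, f u • Φ u) := fun x => by
    rw [← integral_inner (integrable_smul_featureMap Φ f)]
    simp only [inner_smul_right, hΦ, mul_comm]
  rw [inner_integralOp, ← integral_inner (integrable_smul_featureMap Φ g)]
  refine integral_congr_ae (Filter.Eventually.of_forall fun x => ?_)
  simp only [h1, inner_smul_right]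
  rw [real_inner_comm, mul_comm]

omit [CompleteSpace H] in
lemma norm_integral_smul_featureMap_le (Φ : C(Cube d, H)) {κ : ℝ} (hΦ : ∀ x, ‖Φ x‖ ≤ κ)
    (f : L2 d) : ‖∫ u, f u • Φ u‖ ≤ κ * ‖f‖ := by
  have hκ : 0 ≤ κ := (norm_nonneg _).trans (hΦ 0)
  calc _ ≤ ∫ u, ‖f u • Φ u‖ := norm_integral_le_integral_norm _
    _ ≤ ∫ u, κ * ‖f u‖ := by
      refine integral_mono (integrable_smul_featureMap Φ f).norm
        ((integrable_L2 f).norm.const_mul κ) fun u => ?_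
      simp only [norm_smul]
      rw [mul_comm]
      gcongr
      exact hΦ u
    _ = κ * ∫ u, ‖f u‖ := integral_const_mul _ _
    _ ≤ _ := by gcongr; exact integral_norm_le_norm f

end FeatureMap

namespace ReproducingKernel

variable (K : ReproducingKernel d)

/-- The kernel as an operator valued matrix. -/
noncomputable def opMatrix : Matrix (Cube d) (Cube d) (ℝ →L[ℝ] ℝ) :=
  Matrix.of fun x y => K.toMap (x, y) • (1 : ℝ →L[ℝ] ℝ)

lemma posSemidef_finsupp (f : Cube d →₀ ℝ) :
    0 ≤ f.sum fun x w => f.sum fun x' w' => K.toMap (x', x) * w * w' := by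
  have h := (K.posSemidef f.support.card (fun i => (f.support.equivFin.symm i : Cube d)))
  have h2 := h.dotProduct_mulVec_nonneg (fun i => f (f.support.equivFin.symm i : Cube d))
  have key : ∀ g : Cube d → ℝ,
      ∑ x ∈ f.support, g x = ∑ i, g (f.support.equivFin.symm i : Cube d) := fun g => by
    rw [← Finset.sum_coe_sort, ← f.support.equivFin.symm.sum_comp]
  simp only [Finsupp.sum, key]
  refine h2.trans_eq ?_
  simp only [dotProduct, Matrix.mulVec, Finset.mul_sum, Matrix.of_apply, Pi.star_apply,
    star_trivial]
  rw [Finset.sum_comm]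
  refine Finset.sum_congr rfl fun i _ => Finset.sum_congr rfl fun j _ => ?_
  ring

lemma posSemidef_opMatrix : K.opMatrix.PosSemidef := by
  have h := (RKHS.posSemidef_tfae (K := K.opMatrix)).out 0 2
  rw [h]
  refine ⟨?_, fun f => ?_⟩
  · ext x y
    simp [opMatrix, Matrix.conjTranspose_apply, K.symm x y]
  · simpa [opMatrix, mul_comm, mul_left_comm, mul_assoc] using K.posSemidef_finsupp f

/-- A feature map of the kernel. -/
lemma exists_featureMap : ∃ (H : Type) (_ : NormedAddCommGroup H) (_ : InnerProductSpace ℝ H)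
    (_ : CompleteSpace H) (Φ : C(Cube d, H)), ∀ x u, K.toMap (x, u) = inner ℝ (Φ x) (Φ u) := by
  have : Fact K.opMatrix.PosSemidef := ⟨K.posSemidef_opMatrix⟩
  let φ : Cube d → RKHS.OfKernel K.opMatrix := fun x => RKHS.kerFun (RKHS.OfKernel K.opMatrix) x 1
  have hφ : ∀ x u, inner ℝ (φ x) (φ u) = K.toMap (x, u) := fun x u => by
    have := RKHS.kernel_inner (RKHS.OfKernel K.opMatrix) u x (1 : ℝ) (1 : ℝ)
    rw [RKHS.OfKernel.kernel_ofKernel] at this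
    rw [← this, K.symm]
    simp [opMatrix]
  have hcont : Continuous φ := by
    rw [continuous_iff_continuousAt]
    intro x
    rw [ContinuousAt, tendsto_iff_norm_sub_tendsto_zero]
    -- Distances between features are expressed by kernel values, so continuity of the kernel gives
    -- continuity of the feature map.
    have h : ∀ y, ‖φ y - φ x‖ = √(K.toMap (y, y) - 2 * K.toMap (y, x) + K.toMap (x, x)) := by
      intro y
      rw [← hφ, ← hφ, ← hφ, real_inner_self_eq_norm_sq, real_inner_self_eq_norm_sq,
        ← norm_sub_sq_real, Real.sqrt_sq (norm_nonneg _)]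
    simp only [h]
    have hc : Continuous fun y => √(K.toMap (y, y) - 2 * K.toMap (y, x) + K.toMap (x, x)) := by
      fun_prop
    have := hc.tendsto x
    convert this using 2
    rw [eq_comm, Real.sqrt_eq_zero']
    linarith
  exact ⟨RKHS.OfKernel K.opMatrix, inferInstance, inferInstance, inferInstance, ⟨φ, hcont⟩,
    fun x u => (hφ x u).symm⟩

lemma sqrt_apply_self_le_kappa (x : Cube d) : √(K.toMap (x, x)) ≤ K.kappa := by
  have hc : Continuous fun u : Cube d => √(K.toMap (u, u)) := by fun_prop
  exact le_ciSup (isCompact_range hc).bddAbove x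

lemma isPositive_op : K.op.IsPositive := by
  obtain ⟨H, _, _, _, Φ, hΦ⟩ := K.exists_featureMap
  refine ⟨fun f g => ?_, fun f => ?_⟩
  · change inner ℝ (integralOp _ f) g = inner ℝ f (integralOp _ g)
    rw [real_inner_comm _ f, inner_integralOp_featureMap Φ hΦ, inner_integralOp_featureMap Φ hΦ,
      real_inner_comm]
  · rw [ContinuousLinearMap.reApplyInnerSelf_apply]
    change 0 ≤ inner ℝ (integralOp _ f) f
    rw [inner_integralOp_featureMap Φ hΦ]
    exact real_inner_self_nonneg

lemma kappa_nonneg : 0 ≤ K.kappa := (Real.sqrt_nonneg _).trans (K.sqrt_apply_self_le_kappa 0)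

lemma norm_op_le : ‖K.op‖ ≤ K.kappa ^ 2 := by
  obtain ⟨H, _, _, _, Φ, hΦ⟩ := K.exists_featureMap
  have hn : ∀ x, ‖Φ x‖ ≤ K.kappa := fun x => by
    refine le_trans (le_of_eq ?_) (K.sqrt_apply_self_le_kappa x)
    rw [hΦ, real_inner_self_eq_norm_sq, Real.sqrt_sq (norm_nonneg _)]
  refine ContinuousLinearMap.opNorm_le_of_re_inner_le (𝕜 := ℝ) (sq_nonneg _) fun f g hf hg => ?_
  change inner ℝ (integralOp _ f) g ≤ _
  rw [inner_integralOp_featureMap Φ hΦ]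
  calc _ ≤ _ := real_inner_le_norm _ _
    _ ≤ (K.kappa * ‖f‖) * (K.kappa * ‖g‖) := by
      have := K.kappa_nonneg
      gcongr <;> exact norm_integral_smul_featureMap_le Φ hn _
    _ = _ := by rw [hf, hg]; ring

end ReproducingKernel

end Kernels

/-- Distinct orthonormal vectors are at distance `√2`, so balls of radius `1/2` around them are
disjoint open sets in a separable space. -/
lemma HilbertBasis.countable_index {ι E : Type*} [NormedAddCommGroup E] [InnerProductSpace ℝ E]
    [SecondCountableTopology E] (b : HilbertBasis ι ℝ E) : Countable ι := by
  rw [← Set.countable_univ_iff]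
  refine Set.PairwiseDisjoint.countable_of_isOpen (s := fun i => Metric.ball (b i) (1 / 2))
    ?_ (fun _ _ => Metric.isOpen_ball) (fun i _ => ⟨b i, Metric.mem_ball_self (by norm_num)⟩)
  intro i _ j _ hij
  refine Metric.ball_disjoint_ball ?_
  have h0 : inner ℝ (b i) (b j) = 0 := b.orthonormal.2 hij
  have h1 := norm_sub_sq_real (b i) (b j)
  rw [h0, b.orthonormal.1, b.orthonormal.1] at h1
  rw [dist_eq_norm]
  nlinarith [norm_nonneg (b i - b j)]

instance fact_two_ne_top : Fact ((2 : ENNReal) ≠ ⊤) := ⟨by norm_num⟩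

instance secondCountableTopology_L2 (d : ℕ) : SecondCountableTopology (L2 d) :=
  have : MeasurableSpace.CountablyGenerated (Cube d) := countablyGenerated_of_standardBorel
  have : MeasureTheory.IsSeparable (volume : Measure (Cube d)) := inferInstance
  Lp.SecondCountableTopology

/-! ### The covariance operator, its square root and the mixed operator. -/

namespace FunctionalLinearModel

variable {d : ℕ} {Ω : Type*} [MeasurableSpace Ω] {P : Measure Ω}
  (M : FunctionalLinearModel d P)

lemma coeFn_X (ω : Ω) : M.X ω =ᵐ[volume] M.process ω := MemLp.coeFn_toLp _

lemma inner_X (ω : Ω) (f : L2 d) : inner ℝ (M.X ω) f = ∫ u, M.process ω u * f u := by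
  rw [L2.inner_def]
  refine integral_congr_ae ?_
  filter_upwards [M.coeFn_X ω] with u hu
  simp only [hu, RCLike.inner_apply, conj_trivial]
  ring

lemma measurable_inner_X (f : L2 d) : Measurable fun ω => inner ℝ (M.X ω) f := by
  simp only [inner_X]
  refine (StronglyMeasurable.integral_prod_right (ν := volume)
    (f := fun ω u => M.process ω u * f u) ?_).measurable
  exact (M.measurable_process.mul
    ((Lp.stronglyMeasurable f).measurable.comp measurable_snd)).stronglyMeasurable

/-- Joint measurability of the process makes each coordinate of `X` measurable; `X` is the limit of
its partial expansions along the countable family of finite index sets. -/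
lemma measurable_X : Measurable M.X := by
  obtain ⟨w, b, -⟩ := exists_hilbertBasis ℝ (L2 d)
  have := HilbertBasis.countable_index b
  refine measurable_of_tendsto_metrizable' (Filter.atTop (α := Finset w))
    (f := fun s ω => ∑ i ∈ s, b.repr (M.X ω) i • b i) (fun s => ?_)
    (tendsto_pi_nhds.2 fun ω => b.hasSum_repr (M.X ω))
  refine Finset.measurable_sum _ fun i _ => ?_
  refine Measurable.smul_const ?_ _
  simp only [b.repr_apply_apply, real_inner_comm (M.X _) (b i)]
  exact M.measurable_inner_X (b i)

lemma norm_X : ∀ᵐ ω ∂P, ‖M.X ω‖ = 1 := M.norm_process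

lemma integrable_inner_process (ω : Ω) (f : L2 d) : Integrable fun u => M.process ω u * f u :=
  (M.memLp_path ω).integrable_mul (Lp.memLp f)

lemma integral_norm_mul_le (ω : Ω) (f : L2 d) :
    ∫ u, ‖M.process ω u * f u‖ ≤ ‖M.X ω‖ * ‖f‖ := by
  have h := norm_inner_le_norm (𝕜 := ℝ) (E := L2 d) |M.X ω| |f|
  rw [norm_abs_eq_norm, norm_abs_eq_norm, L2.inner_def] at h
  refine le_trans (le_of_eq ?_) ((le_abs_self _).trans h)
  refine integral_congr_ae ?_
  filter_upwards [M.coeFn_X ω, Lp.coeFn_abs (M.X ω), Lp.coeFn_abs f] with u h1 h2 h3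
  simp only [h2, h3, h1, RCLike.inner_apply, conj_trivial, norm_mul, Real.norm_eq_abs]
  ring

variable [IsProbabilityMeasure P]

/-- This justifies the use of Fubini in `inner_covOp`: for almost every `ω` the inner integral is at
most `‖g‖ ‖f‖`, by Cauchy–Schwarz and `‖X‖ = 1`. -/
lemma integrable_process_prod (f g : L2 d) :
    Integrable (fun p : Ω × (Cube d × Cube d) =>
      (M.process p.1 p.2.1 * g p.2.1) * (M.process p.1 p.2.2 * f p.2.2))
      (P.prod (volume.prod volume)) := by
  have hf := (Lp.stronglyMeasurable f).measurable
  have hg := (Lp.stronglyMeasurable g).measurable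
  have hm : Measurable (fun p : Ω × (Cube d × Cube d) =>
      (M.process p.1 p.2.1 * g p.2.1) * (M.process p.1 p.2.2 * f p.2.2)) := by
    have h1 : Measurable fun p : Ω × (Cube d × Cube d) => M.process p.1 p.2.1 :=
      M.measurable_process.comp (measurable_fst.prodMk (measurable_fst.comp measurable_snd))
    have h2 : Measurable fun p : Ω × (Cube d × Cube d) => M.process p.1 p.2.2 :=
      M.measurable_process.comp (measurable_fst.prodMk (measurable_snd.comp measurable_snd))
    fun_prop
  refine (integrable_prod_iff hm.aestronglyMeasurable).2 ⟨?_, ?_⟩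
  · exact Filter.Eventually.of_forall fun ω =>
      (M.integrable_inner_process ω g).mul_prod (M.integrable_inner_process ω f)
  · refine Integrable.mono' (integrable_const (‖g‖ * ‖f‖))
      hm.aestronglyMeasurable.norm.integral_prod_right' ?_
    filter_upwards [M.norm_X] with ω hω
    simp only [norm_mul]
    simp_rw [← norm_mul]
    have h1 := M.integral_norm_mul_le ω g
    have h2 := M.integral_norm_mul_le ω f
    have e : ∀ y : Cube d × Cube d,
        ‖(M.process ω y.1 * g y.1) * (M.process ω y.2 * f y.2)‖
          = ‖M.process ω y.1 * g y.1‖ * ‖M.process ω y.2 * f y.2‖ := fun y => norm_mul _ _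
    simp only [e]
    rw [integral_prod_mul (fun u => ‖M.process ω u * g u‖) (fun u => ‖M.process ω u * f u‖),
      norm_mul, Real.norm_of_nonneg (integral_nonneg fun _ => norm_nonneg _),
      Real.norm_of_nonneg (integral_nonneg fun _ => norm_nonneg _)]
    rw [hω, one_mul] at h1 h2
    gcongr

/-- Fubini turns the kernel `C` into a second moment. Positivity of `L_C`, the bound `‖L_C‖ ≤ 1` and
the link between `L_C^{1/2}` and the error all rest on this identity. -/
lemma inner_covOp (f g : L2 d) :
    inner ℝ (M.covOp f) g = ∫ ω, inner ℝ (M.X ω) f * inner ℝ (M.X ω) g ∂P := by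
  have hI := M.integrable_process_prod f g
  rw [covOp, inner_integralOp]
  have e1 : ∀ ω, inner ℝ (M.X ω) f * inner ℝ (M.X ω) g = ∫ p : Cube d × Cube d,
      (M.process ω p.1 * g p.1) * (M.process ω p.2 * f p.2) ∂(volume.prod volume) := fun ω => by
    rw [integral_prod_mul (fun u => M.process ω u * g u) (fun u => M.process ω u * f u),
      ← inner_X, ← inner_X, mul_comm]
  simp only [e1]
  have hI' : Integrable (fun p : Cube d × Cube d =>
      ∫ ω, (M.process ω p.1 * g p.1) * (M.process ω p.2 * f p.2) ∂P) (volume.prod volume) :=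
    hI.integral_prod_right
  rw [integral_integral_swap hI, integral_prod _ hI']
  refine integral_congr_ae (Filter.Eventually.of_forall fun x => ?_)
  simp only
  rw [← integral_mul_const]
  refine integral_congr_ae (Filter.Eventually.of_forall fun u => ?_)
  change (∫ ω, M.process ω x * M.process ω u ∂P) * f u * g x = _
  rw [← integral_mul_const, ← integral_mul_const]
  refine integral_congr_ae (Filter.Eventually.of_forall fun ω => ?_)
  simp only
  ring

omit [IsProbabilityMeasure P] in
lemma abs_inner_X_le (f : L2 d) : ∀ᵐ ω ∂P, |inner ℝ (M.X ω) f| ≤ ‖f‖ := by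
  filter_upwards [M.norm_X] with ω hω
  simpa [hω] using abs_real_inner_le_norm (M.X ω) f

lemma isPositive_covOp : M.covOp.IsPositive := by
  refine ⟨fun f g => ?_, fun f => ?_⟩
  · change inner ℝ (M.covOp f) g = inner ℝ f (M.covOp g)
    rw [real_inner_comm _ f, inner_covOp, inner_covOp]
    simp only [mul_comm]
  · rw [ContinuousLinearMap.reApplyInnerSelf_apply, inner_covOp]
    exact integral_nonneg fun ω => mul_self_nonneg _

lemma norm_covOp_le : ‖M.covOp‖ ≤ 1 := by
  refine ContinuousLinearMap.opNorm_le_of_re_inner_le (𝕜 := ℝ) zero_le_one fun f g hf hg => ?_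
  rw [inner_covOp]
  suffices h : ∀ᵐ ω ∂P, ‖inner ℝ (M.X ω) f * inner ℝ (M.X ω) g‖ ≤ 1 by
    simpa using (le_abs_self _).trans (norm_integral_le_of_norm_le_const h)
  filter_upwards [M.abs_inner_X_le f, M.abs_inner_X_le g] with ω h1 h2
  rw [norm_mul]
  rw [hf] at h1
  rw [hg] at h2
  exact mul_le_one₀ h1 (norm_nonneg _) h2

omit [IsProbabilityMeasure P] in
lemma isCompactOperator_covOp : IsCompactOperator M.covOp := isCompactOperator_integralOp _

/-- The square root of the covariance operator. -/
noncomputable abbrev sqrtCov : L2 d →L[ℝ] L2 d := opPow M.covOp (1 / 2)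

lemma inner_sqrtCov_left (f g : L2 d) :
    inner ℝ (M.sqrtCov f) g = inner ℝ f (M.sqrtCov g) :=
  inner_opPow_left M.isPositive_covOp (by norm_num) f g

lemma sqrtCov_sqrtCov (f : L2 d) : M.sqrtCov (M.sqrtCov f) = M.covOp f :=
  opPow_half_apply_opPow_half M.isPositive_covOp M.isCompactOperator_covOp f

lemma norm_sqrtCov_le : ‖M.sqrtCov‖ ≤ 1 :=
  (norm_opPow_le M.isPositive_covOp (by norm_num)).trans
    (Real.rpow_le_one (norm_nonneg _) M.norm_covOp_le (by norm_num))

lemma norm_sqrtCov_sq (f : L2 d) : ‖M.sqrtCov f‖ ^ 2 = ∫ ω, inner ℝ (M.X ω) f ^ 2 ∂P := by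
  rw [← real_inner_self_eq_norm_sq, inner_sqrtCov_left, sqrtCov_sqrtCov, real_inner_comm,
    inner_covOp]
  simp only [sq]

lemma inner_mixedOp (K : ReproducingKernel d) (f g : L2 d) :
    inner ℝ (M.mixedOp K f) g = inner ℝ (K.op (M.sqrtCov f)) (M.sqrtCov g) :=
  M.inner_sqrtCov_left _ _

lemma isPositive_mixedOp (K : ReproducingKernel d) : (M.mixedOp K).IsPositive := by
  refine ⟨fun f g => ?_, fun f => ?_⟩
  · change inner ℝ (M.mixedOp K f) g = inner ℝ f (M.mixedOp K g)
    rw [real_inner_comm _ f, inner_mixedOp, inner_mixedOp, real_inner_comm]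
    exact (K.isPositive_op.1 _ _).symm
  · rw [ContinuousLinearMap.reApplyInnerSelf_apply, inner_mixedOp]
    exact K.isPositive_op.2 _

omit [IsProbabilityMeasure P] in
lemma isCompactOperator_mixedOp (K : ReproducingKernel d) : IsCompactOperator (M.mixedOp K) :=
  ((isCompactOperator_integralOp K.toMap).comp_clm (M.sqrtCov)).clm_comp M.sqrtCov

lemma norm_mixedOp_le (K : ReproducingKernel d) : ‖M.mixedOp K‖ ≤ K.kappa ^ 2 := by
  have h1 := M.norm_sqrtCov_le
  calc _ ≤ ‖M.sqrtCov‖ * (‖K.op‖ * ‖M.sqrtCov‖) :=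
        (ContinuousLinearMap.opNorm_comp_le _ _).trans
          (by gcongr; exact ContinuousLinearMap.opNorm_comp_le _ _)
    _ ≤ 1 * (K.kappa ^ 2 * 1) := by gcongr; exact K.norm_op_le
    _ = _ := by ring

end FunctionalLinearModel

/-! ### Moments of a single observation. -/

namespace FunctionalLinearModel

variable {d : ℕ} {Ω : Type*} [MeasurableSpace Ω] {P : Measure Ω} [IsProbabilityMeasure P]
  (M : FunctionalLinearModel d P)

/-- The factor `h(X)` is pulled out of the conditional expectation given `X`. It is used with `Z =
ε`, `a = 0` and with `Z = ε²`, `a = σ²`; boundedness of `h(X)` comes from `‖X‖ = 1`. -/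
lemma integral_comp_X_mul {Z : Ω → ℝ} (hZ : Integrable Z P) {a : ℝ}
    (hc : P[Z | MeasurableSpace.comap M.X inferInstance] =ᵐ[P] fun _ => a)
    {h : L2 d → ℝ} (hm : Measurable h) {C : ℝ} (hb : ∀ᵐ ω ∂P, ‖h (M.X ω)‖ ≤ C) :
    ∫ ω, h (M.X ω) * Z ω ∂P = a * ∫ ω, h (M.X ω) ∂P := by
  have hle := M.measurable_X.comap_le
  have h1 := condExp_stronglyMeasurable_mul_of_bound hle (μ := P) (f := fun ω => h (M.X ω)) (g := Z)
    ((hm.comp (comap_measurable M.X)).stronglyMeasurable) hZ C hb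
  have h2 := integral_condExp (μ := P) (f := (fun ω => h (M.X ω)) * Z) hle
  calc _ = ∫ ω, ((fun ω => h (M.X ω)) * Z) ω ∂P := rfl
    _ = ∫ ω, h (M.X ω) * a ∂P := by
      rw [← h2]
      refine integral_congr_ae ?_
      filter_upwards [h1, hc] with ω h3 h4
      rw [h3, Pi.mul_apply, h4]
    _ = _ := by rw [integral_mul_const, mul_comm]

lemma integrable_noise : Integrable M.noise P := M.memLp_noise.integrable (by norm_num)

omit [IsProbabilityMeasure P] in
lemma integrable_noise_sq : Integrable (fun ω => M.noise ω ^ 2) P := M.memLp_noise.integrable_sq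

lemma integral_comp_X_mul_noise {h : L2 d → ℝ} (hm : Measurable h) {C : ℝ}
    (hb : ∀ᵐ ω ∂P, ‖h (M.X ω)‖ ≤ C) : ∫ ω, h (M.X ω) * M.noise ω ∂P = 0 := by
  rw [M.integral_comp_X_mul M.integrable_noise M.condMean_noise hm hb, zero_mul]

lemma integral_comp_X_mul_noise_sq {h : L2 d → ℝ} (hm : Measurable h) {C : ℝ}
    (hb : ∀ᵐ ω ∂P, ‖h (M.X ω)‖ ≤ C) :
    ∫ ω, h (M.X ω) * M.noise ω ^ 2 ∂P = Var[M.noise; P] * ∫ ω, h (M.X ω) ∂P :=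
  M.integral_comp_X_mul M.integrable_noise_sq M.condVar_noise hm hb

lemma integrable_comp_X {h : L2 d → ℝ} (hm : Measurable h) {C : ℝ}
    (hb : ∀ᵐ ω ∂P, ‖h (M.X ω)‖ ≤ C) : Integrable (fun ω => h (M.X ω)) P :=
  Integrable.of_bound (hm.comp M.measurable_X).aestronglyMeasurable C hb

omit [IsProbabilityMeasure P] in
lemma integrable_comp_X_mul {Z : Ω → ℝ} (hZ : Integrable Z P) {h : L2 d → ℝ} (hm : Measurable h)
    {C : ℝ} (hb : ∀ᵐ ω ∂P, ‖h (M.X ω)‖ ≤ C) : Integrable (fun ω => h (M.X ω) * Z ω) P :=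
  hZ.bdd_mul (c := C) (hm.comp M.measurable_X).aestronglyMeasurable hb

omit [IsProbabilityMeasure P] in
lemma residual_eq (β : L2 d) (ω : Ω) :
    inner ℝ β (M.X ω) - M.Y ω = inner ℝ (β - M.slope) (M.X ω) - M.noise ω := by
  rw [Y, inner_sub_left]; ring

lemma measurable_inner_left (f : L2 d) : Measurable fun x : L2 d => (inner ℝ f x : ℝ) :=
  (continuous_const.inner continuous_id).measurable

omit [IsProbabilityMeasure P] in
lemma norm_inner_left_X_le (f : L2 d) : ∀ᵐ ω ∂P, ‖(inner ℝ f (M.X ω) : ℝ)‖ ≤ ‖f‖ := by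
  filter_upwards [M.abs_inner_X_le f] with ω h
  rwa [real_inner_comm]

omit [IsProbabilityMeasure P] in
lemma norm_inner_mul_inner_X_le (f g : L2 d) :
    ∀ᵐ ω ∂P, ‖(inner ℝ f (M.X ω) * inner ℝ g (M.X ω) : ℝ)‖ ≤ ‖f‖ * ‖g‖ := by
  filter_upwards [M.norm_inner_left_X_le f, M.norm_inner_left_X_le g] with ω h1 h2
  rw [norm_mul]
  gcongr

omit [IsProbabilityMeasure P] in
lemma norm_inner_pow_X_le (f : L2 d) (n : ℕ) :
    ∀ᵐ ω ∂P, ‖(inner ℝ f (M.X ω) ^ n : ℝ)‖ ≤ ‖f‖ ^ n := by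
  filter_upwards [M.norm_inner_left_X_le f] with ω h1
  rw [norm_pow]
  gcongr

omit [IsProbabilityMeasure P] in
lemma norm_inner_mul_inner_sq_X_le (f g : L2 d) :
    ∀ᵐ ω ∂P, ‖(inner ℝ f (M.X ω) * inner ℝ g (M.X ω) ^ 2 : ℝ)‖ ≤ ‖f‖ * ‖g‖ ^ 2 := by
  filter_upwards [M.norm_inner_left_X_le f, M.norm_inner_pow_X_le g 2] with ω h1 h2
  rw [norm_mul]
  gcongr

omit [IsProbabilityMeasure P] in
lemma norm_inner_sq_mul_inner_sq_X_le (f g : L2 d) :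
    ∀ᵐ ω ∂P, ‖(inner ℝ f (M.X ω) ^ 2 * inner ℝ g (M.X ω) ^ 2 : ℝ)‖ ≤ ‖f‖ ^ 2 * ‖g‖ ^ 2 := by
  filter_upwards [M.norm_inner_pow_X_le f 2, M.norm_inner_pow_X_le g 2] with ω h1 h2
  rw [norm_mul]
  gcongr

lemma integral_inner_sq (f : L2 d) :
    ∫ ω, inner ℝ f (M.X ω) ^ 2 ∂P = ‖M.sqrtCov f‖ ^ 2 := by
  rw [norm_sqrtCov_sq]
  simp only [real_inner_comm]

lemma integral_residual_mul (β w : L2 d) :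
    ∫ ω, (inner ℝ β (M.X ω) - M.Y ω) * inner ℝ w (M.X ω) ∂P
      = inner ℝ (M.sqrtCov (β - M.slope)) (M.sqrtCov w) := by
  have hmw := measurable_inner_left w
  have hme := measurable_inner_left (β - M.slope)
  have h1 := M.integral_comp_X_mul_noise hmw (M.norm_inner_left_X_le w)
  have i1 := M.integrable_comp_X_mul M.integrable_noise hmw (M.norm_inner_left_X_le w)
  have i2 := M.integrable_comp_X (hme.mul hmw) (M.norm_inner_mul_inner_X_le (β - M.slope) w)
  have e : ∀ ω, (inner ℝ β (M.X ω) - M.Y ω) * inner ℝ w (M.X ω)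
      = inner ℝ (β - M.slope) (M.X ω) * inner ℝ w (M.X ω) - inner ℝ w (M.X ω) * M.noise ω :=
    fun ω => by rw [residual_eq]; ring
  simp only [e]
  refine (integral_sub i2 i1).trans ?_
  rw [h1, sub_zero, ← inner_sqrtCov_left, sqrtCov_sqrtCov, inner_covOp]
  refine integral_congr_ae (Filter.Eventually.of_forall fun ω => ?_)
  simp only [real_inner_comm, Pi.mul_apply]

/-- The moment condition for two directions, deduced from that for one by a weighted
arithmetic–geometric mean inequality. -/
lemma integral_inner_sq_mul_inner_sq_le {c : ℝ} (hc : 0 ≤ c) (hM : M.MomentCondition c)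
    (f g : L2 d) :
    ∫ ω, inner ℝ f (M.X ω) ^ 2 * inner ℝ g (M.X ω) ^ 2 ∂P
      ≤ c * ‖M.sqrtCov f‖ ^ 2 * ‖M.sqrtCov g‖ ^ 2 := by
  have h4 : ∀ f : L2 d, ∫ ω, inner ℝ f (M.X ω) ^ 4 ∂P ≤ c * (‖M.sqrtCov f‖ ^ 2) ^ 2 := fun f => by
    have := hM f
    rw [← norm_sqrtCov_sq] at this
    simpa only [real_inner_comm] using this
  have i4 : ∀ f : L2 d, Integrable (fun ω => inner ℝ f (M.X ω) ^ 4) P := fun f =>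
    M.integrable_comp_X ((measurable_inner_left f).pow_const 4) (M.norm_inner_pow_X_le f 4)
  have i22 : Integrable (fun ω => inner ℝ f (M.X ω) ^ 2 * inner ℝ g (M.X ω) ^ 2) P :=
    M.integrable_comp_X (((measurable_inner_left f).pow_const 2).mul
      ((measurable_inner_left g).pow_const 2)) (M.norm_inner_sq_mul_inner_sq_X_le f g)
  have hz : ∀ f : L2 d, ‖M.sqrtCov f‖ = 0 → ∀ᵐ ω ∂P, inner ℝ f (M.X ω) = 0 := fun f hf => by
    have h := integral_inner_sq M f
    rw [hf, zero_pow two_ne_zero, integral_eq_zero_iff_of_nonneg (fun ω => sq_nonneg _)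
      (M.integrable_comp_X ((measurable_inner_left f).pow_const 2) (M.norm_inner_pow_X_le f 2))] at h
    · filter_upwards [h] with ω hω
      simpa using hω
  -- A direction of zero variance would make the weights below degenerate, but there the integrand
  -- vanishes almost surely.
  by_cases hf : ‖M.sqrtCov f‖ = 0
  · rw [integral_eq_zero_of_ae]
    · positivity
    · filter_upwards [hz f hf] with ω hω
      simp [hω]
  by_cases hg : ‖M.sqrtCov g‖ = 0
  · rw [integral_eq_zero_of_ae]
    · positivity
    · filter_upwards [hz g hg] with ω hω
      simp [hω]
  have hf' : 0 < ‖M.sqrtCov f‖ := lt_of_le_of_ne (norm_nonneg _) (Ne.symm hf)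
  have hg' : 0 < ‖M.sqrtCov g‖ := lt_of_le_of_ne (norm_nonneg _) (Ne.symm hg)
  set a := ‖M.sqrtCov f‖
  set b := ‖M.sqrtCov g‖
  -- The weights `b²` and `a²` equalize the two bounds: each weighted fourth moment is at most `c a⁴
  -- b⁴`.
  have key : ∀ ω, (a ^ 2 * b ^ 2) * (inner ℝ f (M.X ω) ^ 2 * inner ℝ g (M.X ω) ^ 2)
      ≤ (b ^ 4 * inner ℝ f (M.X ω) ^ 4 + a ^ 4 * inner ℝ g (M.X ω) ^ 4) / 2 := fun ω => by
    nlinarith [sq_nonneg (b ^ 2 * inner ℝ f (M.X ω) ^ 2 - a ^ 2 * inner ℝ g (M.X ω) ^ 2)]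
  have h5 : (a ^ 2 * b ^ 2) * ∫ ω, inner ℝ f (M.X ω) ^ 2 * inner ℝ g (M.X ω) ^ 2 ∂P
      ≤ (b ^ 4 * ∫ ω, inner ℝ f (M.X ω) ^ 4 ∂P + a ^ 4 * ∫ ω, inner ℝ g (M.X ω) ^ 4 ∂P) / 2 := by
    rw [← integral_const_mul, ← integral_const_mul, ← integral_const_mul,
      ← integral_add ((i4 f).const_mul _) ((i4 g).const_mul _), ← integral_div]
    exact integral_mono (i22.const_mul _)
      ((((i4 f).const_mul _).add ((i4 g).const_mul _)).div_const 2) key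
  have h6 : (a ^ 2 * b ^ 2) * ∫ ω, inner ℝ f (M.X ω) ^ 2 * inner ℝ g (M.X ω) ^ 2 ∂P
      ≤ (a ^ 2 * b ^ 2) * (c * a ^ 2 * b ^ 2) := by
    refine h5.trans ?_
    have h7 := mul_le_mul_of_nonneg_left (h4 f) (by positivity : 0 ≤ b ^ 4)
    have h8 := mul_le_mul_of_nonneg_left (h4 g) (by positivity : 0 ≤ a ^ 4)
    change b ^ 4 * _ ≤ b ^ 4 * (c * (a ^ 2) ^ 2) at h7
    change a ^ 4 * _ ≤ a ^ 4 * (c * (b ^ 2) ^ 2) at h8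
    calc _ ≤ (b ^ 4 * (c * (a ^ 2) ^ 2) + a ^ 4 * (c * (b ^ 2) ^ 2)) / 2 := by gcongr
      _ = _ := by ring
  exact le_of_mul_le_mul_left h6 (by positivity)

/-- The residual is `⟨β - β⋆, X⟩ - ε`. After squaring, the cross term vanishes by the conditional
mean, `ε²` averages to `σ²` given `X`, and the rest is a mixed fourth moment. -/
lemma integral_residual_sq_mul_le {c : ℝ} (hc : 0 ≤ c) (hM : M.MomentCondition c) (β w : L2 d) :
    ∫ ω, ((inner ℝ β (M.X ω) - M.Y ω) * inner ℝ w (M.X ω)) ^ 2 ∂P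
      ≤ (c * ‖M.sqrtCov (β - M.slope)‖ ^ 2 + Var[M.noise; P]) * ‖M.sqrtCov w‖ ^ 2 := by
  have hmw := measurable_inner_left w
  set e := β - M.slope with he
  have hme := measurable_inner_left e
  have h1 := M.integral_comp_X_mul_noise (hme.mul (hmw.pow_const 2))
    (M.norm_inner_mul_inner_sq_X_le e w)
  have i1 := M.integrable_comp_X_mul M.integrable_noise (hme.mul (hmw.pow_const 2))
    (M.norm_inner_mul_inner_sq_X_le e w)
  have h2 := M.integral_comp_X_mul_noise_sq (hmw.pow_const 2) (M.norm_inner_pow_X_le w 2)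
  have i2 := M.integrable_comp_X_mul M.integrable_noise_sq (hmw.pow_const 2)
    (M.norm_inner_pow_X_le w 2)
  have i3 := M.integrable_comp_X ((hme.pow_const 2).mul (hmw.pow_const 2))
    (M.norm_inner_sq_mul_inner_sq_X_le e w)
  have h3 := M.integral_inner_sq_mul_inner_sq_le hc hM e w
  rw [integral_inner_sq] at h2
  simp only [Pi.mul_apply] at h1 i1 i3
  have ee : ∀ ω, ((inner ℝ β (M.X ω) - M.Y ω) * inner ℝ w (M.X ω)) ^ 2
      = (inner ℝ e (M.X ω) ^ 2 * inner ℝ w (M.X ω) ^ 2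
        - 2 * (inner ℝ e (M.X ω) * inner ℝ w (M.X ω) ^ 2 * M.noise ω))
        + inner ℝ w (M.X ω) ^ 2 * M.noise ω ^ 2 :=
    fun ω => by rw [residual_eq]; ring
  simp only [ee]
  have i4 : Integrable (fun ω => inner ℝ e (M.X ω) ^ 2 * inner ℝ w (M.X ω) ^ 2
      - 2 * (inner ℝ e (M.X ω) * inner ℝ w (M.X ω) ^ 2 * M.noise ω)) P := i3.sub (i1.const_mul 2)
  rw [integral_add i4 i2, integral_sub i3 (i1.const_mul 2), integral_const_mul, h1, h2]
  linarith

lemma excessError_inner (β : L2 d) :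
    M.excessError (fun f => inner ℝ β f) = ‖M.sqrtCov (β - M.slope)‖ ^ 2 := by
  set e := β - M.slope with he
  have hme := measurable_inner_left e
  have h1 := M.integral_comp_X_mul_noise hme (M.norm_inner_left_X_le e)
  have i1 := M.integrable_comp_X_mul M.integrable_noise hme (M.norm_inner_left_X_le e)
  have i2 := M.integrable_comp_X (hme.pow_const 2) (M.norm_inner_pow_X_le e 2)
  have ee : ∀ ω, (M.Y ω - inner ℝ β (M.X ω)) ^ 2 - (M.Y ω - inner ℝ M.slope (M.X ω)) ^ 2
      = inner ℝ e (M.X ω) ^ 2 - 2 * (inner ℝ e (M.X ω) * M.noise ω) := fun ω => by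
    rw [he, inner_sub_left, Y]; ring
  simp only [excessError, ee]
  rw [integral_sub i2 (i1.const_mul 2), integral_const_mul, h1, integral_inner_sq]
  ring

lemma memLp_Y : MemLp M.Y 2 P := by
  have : MemLp (fun ω => (inner ℝ M.slope (M.X ω) : ℝ)) 2 P :=
    MemLp.of_bound ((measurable_inner_left M.slope).comp M.measurable_X).aestronglyMeasurable _
      (M.norm_inner_left_X_le M.slope)
  exact this.add M.memLp_noise

end FunctionalLinearModel

/-! ### Independence of the current state from the next input. -/

section Independence

variable {Ω E F : Type*} {mΩ : MeasurableSpace Ω} [mE : MeasurableSpace E] [mF : MeasurableSpace F]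
  {μ : Measure Ω}

/-- A measurable recursion driven by independent inputs is independent of the next input. -/
lemma indepFun_of_recursion {z : ℕ → Ω → F} (hz : ∀ n, Measurable (z n)) (hi : iIndepFun z μ)
    {b : ℕ → Ω → E} {b₀ : E} (hb₀ : ∀ ω, b 0 ω = b₀) {Φ : ℕ → E × F → E}
    (hΦ : ∀ n, Measurable (Φ n)) (hb : ∀ n ω, b (n + 1) ω = Φ n (b n ω, z n ω)) (n : ℕ) :
    Measurable (b n) ∧ IndepFun (b n) (z n) μ := by
  let m : ℕ → MeasurableSpace Ω := fun k => MeasurableSpace.comap (z k) mF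
  -- The state `b n` uses only the inputs with index strictly below `n`, which leaves `z n`
  -- independent of it.
  have hm : ∀ n, Measurable[⨆ k ∈ Set.Iio n, m k] (b n) := by
    intro n
    induction n with
    | zero =>
      have : b 0 = fun _ => b₀ := funext hb₀
      rw [this]
      exact measurable_const
    | succ n ih =>
      have h1 : Measurable[⨆ k ∈ Set.Iio (n + 1), m k] (b n) :=
        ih.mono (biSup_mono fun k hk => Set.mem_Iio.2 ((Set.mem_Iio.1 hk).trans n.lt_succ_self))
          le_rfl
      have h2 : Measurable[⨆ k ∈ Set.Iio (n + 1), m k] (z n) :=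
        Measurable.mono (comap_measurable (z n))
          (le_biSup m (Set.mem_Iio.2 n.lt_succ_self)) le_rfl
      have : b (n + 1) = fun ω => Φ n (b n ω, z n ω) := funext (hb n)
      rw [this]
      exact (hΦ n).comp (h1.prodMk h2)
  have hle : ∀ k, m k ≤ mΩ := fun k => (hz k).comap_le
  refine ⟨(hm n).mono (iSup₂_le fun k _ => hle k) le_rfl, ?_⟩
  have h := indep_iSup_of_disjoint hle ((iIndepFun_iff_iIndep _ _ _).1 hi)
    (S := Set.Iio n) (T := {n}) (by simp)
  rw [IndepFun_iff_Indep]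
  refine indep_of_indep_of_le_left (indep_of_indep_of_le_right h ?_) (hm n).comap_le
  exact le_biSup m (Set.mem_singleton n)

/-- Equality in law only provides almost everywhere measurable samples. The recursion is rerun on
measurable versions, and almost sure equality propagates by induction. -/
lemma aemeasurable_indepFun_of_recursion {z : ℕ → Ω → F} (hz : ∀ n, AEMeasurable (z n) μ)
    (hi : iIndepFun z μ) {b : ℕ → Ω → E} {b₀ : E} (hb₀ : ∀ ω, b 0 ω = b₀) {Φ : ℕ → E × F → E}
    (hΦ : ∀ n, Measurable (Φ n)) (hb : ∀ n ω, b (n + 1) ω = Φ n (b n ω, z n ω)) (n : ℕ) :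
    AEMeasurable (b n) μ ∧ IndepFun (b n) (z n) μ := by
  let z' : ℕ → Ω → F := fun n => (hz n).mk (z n)
  let b' : ℕ → Ω → E := fun n ω => Nat.rec b₀ (fun n e => Φ n (e, z' n ω)) n
  have hzz : ∀ n, z n =ᵐ[μ] z' n := fun n => (hz n).ae_eq_mk
  have hbb : ∀ n, b n =ᵐ[μ] b' n := by
    intro n
    induction n with
    | zero => exact Filter.Eventually.of_forall hb₀
    | succ n ih =>
      filter_upwards [ih, hzz n] with ω h1 h2
      rw [hb, h1, h2]
  obtain ⟨h1, h2⟩ := indepFun_of_recursion (z := z') (b := b') (fun n => (hz n).measurable_mk)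
    (hi.congr hzz) (fun _ => rfl) hΦ (fun _ _ => rfl) n
  exact ⟨⟨b' n, h1, hbb n⟩, h2.congr (hbb n).symm (hzz n).symm⟩

/-- Fubini for a function of two independent variables, the law of the second one being realized
on another probability space. -/
lemma integral_indepFun_identDistrib [IsProbabilityMeasure μ] {Ω₂ : Type*} [MeasurableSpace Ω₂]
    {ν : Measure Ω₂} [IsProbabilityMeasure ν] {b : Ω → E} {z : Ω → F} {w : Ω₂ → F}
    (hb : AEMeasurable b μ) (hbz : IndepFun b z μ) (hzw : IdentDistrib z w μ ν) {G : E × F → ℝ}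
    (hG : Measurable G) (hint : Integrable (fun ω => G (b ω, z ω)) μ) :
    ∫ ω, G (b ω, z ω) ∂μ = ∫ ω, ∫ ω₂, G (b ω, w ω₂) ∂ν ∂μ ∧
      Integrable (fun ω => ∫ ω₂, G (b ω, w ω₂) ∂ν) μ := by
  have hz := hzw.aemeasurable_fst
  have hw := hzw.aemeasurable_snd
  have hmap : μ.map (fun ω => (b ω, z ω)) = (μ.map b).prod (ν.map w) := by
    rw [hbz.map_prod_eq_prod_map_map hb hz, hzw.map_eq]
  have : IsProbabilityMeasure (μ.map b) := Measure.isProbabilityMeasure_map hb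
  have : IsProbabilityMeasure (ν.map w) := Measure.isProbabilityMeasure_map hw
  have hint' : Integrable G ((μ.map b).prod (ν.map w)) := by
    rw [← hmap]
    exact (integrable_map_measure hG.aestronglyMeasurable (hb.prodMk hz)).2 hint
  have hin : ∀ e, ∫ f, G (e, f) ∂(ν.map w) = ∫ ω₂, G (e, w ω₂) ∂ν := fun e =>
    integral_map hw (hG.comp measurable_prodMk_left).aestronglyMeasurable
  have hI := hint'.integral_prod_left
  constructor
  · rw [← integral_map (hb.prodMk hz) hG.aestronglyMeasurable, hmap, integral_prod _ hint',
      integral_map hb hI.aestronglyMeasurable]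
    simp only [hin]
  · have := (integrable_map_measure hI.aestronglyMeasurable hb).1 hI
    simpa only [Function.comp_def, hin] using this

end Independence

/-! ### Second moments along stochastic gradient descent. -/

section Descent

variable {d : ℕ} {Ω : Type*} [MeasurableSpace Ω] {P : Measure Ω} [IsProbabilityMeasure P]
  {M : FunctionalLinearModel d P} {Ω' : Type*} [MeasurableSpace Ω'] {P' : Measure Ω'}
  [IsProbabilityMeasure P'] {K : ReproducingKernel d} {x : ℕ → Ω' → L2 d} {y : ℕ → Ω' → ℝ}
  {η : ℕ → ℝ} {β : ℕ → Ω' → L2 d}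

/-- One step of stochastic gradient descent. -/
noncomputable def sgdStep (K : ReproducingKernel d) (a : ℝ) (p : L2 d × (L2 d × ℝ)) : L2 d :=
  p.1 - (a * (inner ℝ p.1 p.2.1 - p.2.2)) • K.op p.2.1

lemma measurable_sgdStep (K : ReproducingKernel d) (a : ℝ) : Measurable (sgdStep K a) := by
  have : Continuous (sgdStep K a) := by
    unfold sgdStep
    fun_prop
  exact this.measurable

omit [MeasurableSpace Ω'] in
lemma sgd_add_two (hβ : ∀ t ω, β t ω = sgd K η (fun k => x k ω) (fun k => y k ω) t) (n : ℕ)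
    (ω : Ω') : β (n + 2) ω = sgdStep K (η (n + 1)) (β (n + 1) ω, (x (n + 1) ω, y (n + 1) ω)) := by
  rw [hβ, hβ]
  rfl

omit [IsProbabilityMeasure P] [IsProbabilityMeasure P'] in
lemma sgd_aemeasurable_indepFun (hS : M.IsSample P' x y)
    (hβ : ∀ t ω, β t ω = sgd K η (fun k => x k ω) (fun k => y k ω) t) (n : ℕ) :
    AEMeasurable (β (n + 1)) P' ∧
      IndepFun (β (n + 1)) (fun ω => (x (n + 1) ω, y (n + 1) ω)) P' :=
  -- Indices are shifted by one: the recursion starts at `β 1 = 0`, and its input number `n` is the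
  -- sample `n + 1`.
  aemeasurable_indepFun_of_recursion (b := fun n => β (n + 1)) (b₀ := 0)
    (Φ := fun n => sgdStep K (η (n + 1)))
    (fun n => (hS.2 (n + 1) (Nat.le_add_left 1 n)).aemeasurable_fst) hS.1 (fun ω => hβ 1 ω)
    (fun _ => measurable_sgdStep K _) (fun n ω => sgd_add_two hβ n ω) n

omit [IsProbabilityMeasure P] [IsProbabilityMeasure P'] in
lemma sample_norm (hS : M.IsSample P' x y) (n : ℕ) : ∀ᵐ ω ∂P', ‖x (n + 1) ω‖ = 1 := by
  have h := (hS.2 (n + 1) (Nat.le_add_left 1 n)).symm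
  refine (h.comp measurable_fst).ae_snd (p := fun f : L2 d => ‖f‖ = 1) ?_ M.norm_X
  exact measurableSet_eq_fun measurable_norm measurable_const

omit [IsProbabilityMeasure P'] in
lemma sample_memLp (hS : M.IsSample P' x y) (n : ℕ) : MemLp (y (n + 1)) 2 P' :=
  ((hS.2 (n + 1) (Nat.le_add_left 1 n)).symm.comp measurable_snd).memLp_snd M.memLp_Y

omit [IsProbabilityMeasure P'] in
lemma residual_memLp (hS : M.IsSample P' x y) {n : ℕ} (hβ : MemLp (β (n + 1)) 2 P') :
    MemLp (fun ω => (inner ℝ (β (n + 1) ω) (x (n + 1) ω) - y (n + 1) ω : ℝ)) 2 P' := by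
  refine MemLp.sub ?_ (sample_memLp hS n)
  have hx : AEMeasurable (x (n + 1)) P' :=
    measurable_fst.comp_aemeasurable (hS.2 (n + 1) (Nat.le_add_left 1 n)).aemeasurable_fst
  refine MemLp.of_le hβ.norm (hβ.aestronglyMeasurable.inner hx.aestronglyMeasurable) ?_
  filter_upwards [sample_norm hS n] with ω hω
  simpa [hω] using norm_inner_le_norm (𝕜 := ℝ) (β (n + 1) ω) (x (n + 1) ω)

omit [IsProbabilityMeasure P'] in
lemma sgd_memLp (hS : M.IsSample P' x y)
    (hβ : ∀ t ω, β t ω = sgd K η (fun k => x k ω) (fun k => y k ω) t) (n : ℕ) :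
    MemLp (β (n + 1)) 2 P' := by
  induction n with
  | zero =>
    have : β 1 = fun _ => 0 := funext fun ω => hβ 1 ω
    rw [this]
    exact MemLp.zero
  | succ n ih =>
    have hx : AEMeasurable (x (n + 1)) P' :=
      measurable_fst.comp_aemeasurable (hS.2 (n + 1) (Nat.le_add_left 1 n)).aemeasurable_fst
    have h1 := (residual_memLp hS ih).const_mul (η (n + 1))
    have h2 : MemLp (fun ω => (η (n + 1) * (inner ℝ (β (n + 1) ω) (x (n + 1) ω) - y (n + 1) ω))
        • K.op (x (n + 1) ω)) 2 P' := by
      refine MemLp.of_le (h1.norm.const_mul ‖K.op‖) (h1.aestronglyMeasurable.smul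
        (K.op.continuous.measurable.comp_aemeasurable hx).aestronglyMeasurable) ?_
      filter_upwards [sample_norm hS n] with ω hω
      have h3 := K.op.le_opNorm (x (n + 1) ω)
      rw [hω, mul_one] at h3
      rw [norm_smul, mul_comm, norm_mul ‖K.op‖, norm_norm, norm_norm]
      gcongr
    have : β (n + 1 + 1) = fun ω => sgdStep K (η (n + 1)) (β (n + 1) ω, (x (n + 1) ω, y (n + 1) ω)) :=
      funext fun ω => sgd_add_two hβ n ω
    rw [this]
    exact ih.sub h2

omit [IsProbabilityMeasure P] in
lemma memLp_sqrtCov_sub {b : Ω' → L2 d} (hb : MemLp b 2 P') :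
    MemLp (fun ω => M.sqrtCov (b ω - M.slope)) 2 P' :=
  M.sqrtCov.comp_memLp' (hb.sub (memLp_const _))

omit [IsProbabilityMeasure P] in
lemma memLp_coord {b : Ω' → L2 d} (hb : MemLp b 2 P') (φ : L2 d) :
    MemLp (fun ω => (inner ℝ (M.sqrtCov (b ω - M.slope)) φ : ℝ)) 2 P' := by
  have h := (innerSL ℝ φ).comp_memLp' (memLp_sqrtCov_sub (M := M) hb)
  refine h.ae_eq (Filter.Eventually.of_forall fun ω => ?_)
  simp [real_inner_comm]

/-- Evolution of the mean square of a coordinate in an eigendirection of the mixed operator. -/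
lemma integral_coord_sq_succ_le {c : ℝ} (hc : 0 ≤ c) (hM : M.MomentCondition c)
    (hS : M.IsSample P' x y)
    (hβ : ∀ t ω, β t ω = sgd K η (fun k => x k ω) (fun k => y k ω) t) {φ : L2 d} (hφ : ‖φ‖ = 1)
    {ev : ℝ} (hev : M.mixedOp K φ = ev • φ) (n : ℕ) :
    ∫ ω, (inner ℝ (M.sqrtCov (β (n + 2) ω - M.slope)) φ) ^ 2 ∂P' ≤
      (1 - η (n + 1) * ev) ^ 2 * ∫ ω, (inner ℝ (M.sqrtCov (β (n + 1) ω - M.slope)) φ) ^ 2 ∂P'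
      + η (n + 1) ^ 2 * ev ^ 2 *
        (c * ∫ ω, ‖M.sqrtCov (β (n + 1) ω - M.slope)‖ ^ 2 ∂P' + Var[M.noise; P]) := by
  -- The direction `w = L_K L_C^{1/2} φ` is dual to the update: `⟨L_C^{1/2} L_K x, φ⟩ = ⟨w, x⟩`. The
  -- eigenvalue equation says `L_C^{1/2} w = ev φ`, which closes the recursion on one coordinate.
  set w : L2 d := K.op (M.sqrtCov φ) with hw
  have hsw : M.sqrtCov w = ev • φ := hev
  obtain ⟨hmeas, hind⟩ := sgd_aemeasurable_indepFun hS hβ n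
  have hL := sgd_memLp hS hβ n
  have hid := hS.2 (n + 1) (Nat.le_add_left 1 n)
  have hR := residual_memLp hS hL
  set f : Ω' → ℝ := fun ω => inner ℝ (M.sqrtCov (β (n + 1) ω - M.slope)) φ with hf
  have hfL : MemLp f 2 P' := memLp_coord hL φ
  set r : Ω' → ℝ := fun ω => (inner ℝ (β (n + 1) ω) (x (n + 1) ω) - y (n + 1) ω)
    * inner ℝ w (x (n + 1) ω) with hr
  have hx : AEMeasurable (x (n + 1)) P' := measurable_fst.comp_aemeasurable hid.aemeasurable_fst
  have hrL : MemLp r 2 P' := by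
    have hwx : AEStronglyMeasurable (fun ω => (inner ℝ w (x (n + 1) ω) : ℝ)) P' :=
      ((FunctionalLinearModel.measurable_inner_left w).comp_aemeasurable hx).aestronglyMeasurable
    refine MemLp.of_le (hR.norm.const_mul ‖w‖) (hR.aestronglyMeasurable.mul hwx) ?_
    filter_upwards [sample_norm hS n] with ω hω
    have h3 := norm_inner_le_norm (𝕜 := ℝ) w (x (n + 1) ω)
    rw [hω, mul_one] at h3
    rw [hr, norm_mul, norm_mul, norm_norm, norm_norm, mul_comm]
    gcongr
  have hrec : ∀ ω, inner ℝ (M.sqrtCov (β (n + 2) ω - M.slope)) φ = f ω - η (n + 1) * r ω := by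
    intro ω
    have e1 : inner ℝ (M.sqrtCov (K.op (x (n + 1) ω))) φ = inner ℝ w (x (n + 1) ω) := by
      rw [M.inner_sqrtCov_left]
      exact (K.isPositive_op.1 _ _).trans (real_inner_comm _ _)
    rw [sgd_add_two hβ, sgdStep]
    simp only [hf, hr]
    rw [sub_right_comm, map_sub, map_smul, inner_sub_left, inner_smul_left, e1]
    simp only [conj_trivial]
    ring
  -- the two conditional expectations given the past
  have hcross := integral_indepFun_identDistrib hmeas hind hid
    (G := fun p => inner ℝ (M.sqrtCov (p.1 - M.slope)) φ *
      ((inner ℝ p.1 p.2.1 - p.2.2) * inner ℝ w p.2.1))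
    (by
      refine Continuous.measurable ?_
      fun_prop) (hfL.integrable_mul hrL)
  have hsq := integral_indepFun_identDistrib hmeas hind hid
    (G := fun p => ((inner ℝ p.1 p.2.1 - p.2.2) * inner ℝ w p.2.1) ^ 2)
    (by
      refine Continuous.measurable ?_
      fun_prop) hrL.integrable_sq
  have h1 : ∫ ω, f ω * r ω ∂P' = ev * ∫ ω, f ω ^ 2 ∂P' := by
    rw [← integral_const_mul]
    refine hcross.1.trans (integral_congr_ae (Filter.Eventually.of_forall fun ω => ?_))
    simp only
    rw [integral_const_mul, M.integral_residual_mul, hsw, inner_smul_right]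
    simp only [hf]
    ring
  have h2 : ∫ ω, r ω ^ 2 ∂P' ≤ ev ^ 2 *
      (c * ∫ ω, ‖M.sqrtCov (β (n + 1) ω - M.slope)‖ ^ 2 ∂P' + Var[M.noise; P]) := by
    have iN : Integrable (fun ω => ‖M.sqrtCov (β (n + 1) ω - M.slope)‖ ^ 2) P' :=
      (memLp_sqrtCov_sub hL).integrable_norm_pow (by norm_num)
    have iN' := ((iN.const_mul c).add (integrable_const Var[M.noise; P])).const_mul (ev ^ 2)
    calc ∫ ω, r ω ^ 2 ∂P' = _ := hsq.1
      _ ≤ ∫ ω, ev ^ 2 * (c * ‖M.sqrtCov (β (n + 1) ω - M.slope)‖ ^ 2 + Var[M.noise; P]) ∂P' := by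
        refine integral_mono hsq.2 iN' fun ω => ?_
        refine (M.integral_residual_sq_mul_le hc hM _ w).trans (le_of_eq ?_)
        rw [hsw, norm_smul, hφ, mul_one, Real.norm_eq_abs, sq_abs, mul_comm]
      _ = _ := by
        rw [integral_const_mul, integral_add (iN.const_mul c) (integrable_const _),
          integral_const_mul]
        simp
  have h3 : ∫ ω, (inner ℝ (M.sqrtCov (β (n + 2) ω - M.slope)) φ) ^ 2 ∂P'
      = ∫ ω, f ω ^ 2 ∂P' - 2 * η (n + 1) * ∫ ω, f ω * r ω ∂P'
        + η (n + 1) ^ 2 * ∫ ω, r ω ^ 2 ∂P' := by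
    have i1 := hfL.integrable_sq
    have i2 : Integrable (fun ω => f ω * r ω) P' := hfL.integrable_mul hrL
    have i3 := hrL.integrable_sq
    have i4 : Integrable (fun ω => f ω ^ 2 - 2 * η (n + 1) * (f ω * r ω)) P' :=
      i1.sub (i2.const_mul _)
    rw [← integral_const_mul, ← integral_const_mul, ← integral_sub i1 (i2.const_mul _),
      ← integral_add i4 (i3.const_mul _)]
    refine integral_congr_ae (Filter.Eventually.of_forall fun ω => ?_)
    simp only [hrec]
    ring
  have h4 : 0 ≤ ∫ ω, f ω ^ 2 ∂P' := integral_nonneg fun ω => sq_nonneg _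
  -- The expansion gives the factor `1 - 2 η ev`; adding the nonnegative term `(η ev)² ∫ f²`
  -- completes the square.
  rw [h3, h1]
  have h5 := mul_le_mul_of_nonneg_left h2 (sq_nonneg (η (n + 1)))
  nlinarith [mul_nonneg (sq_nonneg (η (n + 1) * ev)) h4]

end Descent

/-! ### Scalar recursions and sums of powers. -/

section Scalar

open Real

/-- The step size sequence `(k+1)^{-θ}`, indexed from `0`. -/
noncomputable def stepSeq (θ : ℝ) (k : ℕ) : ℝ := ((k : ℝ) + 1) ^ (-θ)

/-- The partial sum of the step sizes over `k ≤ j < n`. -/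
noncomputable def stepSum (θ : ℝ) (k n : ℕ) : ℝ := ∑ j ∈ Finset.Ico k n, stepSeq θ j

lemma stepSeq_pos (θ : ℝ) (k : ℕ) : 0 < stepSeq θ k := by unfold stepSeq; positivity

lemma stepSeq_le_one {θ : ℝ} (hθ : 0 ≤ θ) (k : ℕ) : stepSeq θ k ≤ 1 :=
  rpow_le_one_of_one_le_of_nonpos (by linarith [k.cast_nonneg (α := ℝ)]) (by linarith)

lemma stepSum_nonneg (θ : ℝ) (k n : ℕ) : 0 ≤ stepSum θ k n :=
  Finset.sum_nonneg fun j _ => (stepSeq_pos θ j).le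

lemma stepSum_succ (θ : ℝ) {k n : ℕ} (h : k ≤ n) :
    stepSum θ k (n + 1) = stepSum θ k n + stepSeq θ n := Finset.sum_Ico_succ_top h _

lemma stepSum_self (θ : ℝ) (n : ℕ) : stepSum θ n n = 0 := by simp [stepSum]

lemma le_stepSum {θ : ℝ} (hθ : 0 ≤ θ) {k n : ℕ} (h : k ≤ n) :
    ((n : ℝ) - k) * (n : ℝ) ^ (-θ) ≤ stepSum θ k n := by
  have h1 : ∀ j ∈ Finset.Ico k n, (n : ℝ) ^ (-θ) ≤ stepSeq θ j := fun j hj => by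
    have hj' : (j : ℝ) + 1 ≤ n := by exact_mod_cast (Finset.mem_Ico.1 hj).2
    exact rpow_le_rpow_of_nonpos (by positivity) hj' (by linarith)
  have := Finset.card_nsmul_le_sum _ _ _ h1
  rw [Nat.card_Ico, nsmul_eq_mul, Nat.cast_sub h] at this
  exact this

/-- This is `y ≤ e^y` at `y = x / p`, raised to the power `p`. -/
lemma rpow_le_rpow_self_mul_exp {x p : ℝ} (hx : 0 ≤ x) (hp : 0 < p) :
    x ^ p ≤ p ^ p * exp x := by
  have h1 : x / p ≤ exp (x / p) := by linarith [add_one_le_exp (x / p)]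
  have h2 := rpow_le_rpow (by positivity) h1 hp.le
  rw [div_rpow hx hp.le, ← exp_mul, div_mul_cancel₀ _ hp.ne', div_le_iff₀ (by positivity)] at h2
  linarith

/-- Decay of `ev ^ p * exp (-2 ev η₀ S)` in `S`, uniformly in `ev ≤ η₀⁻¹`. -/
lemma rpow_mul_exp_le {ev η₀ S p : ℝ} (hev : 0 ≤ ev) (hη : 0 < η₀) (h1 : η₀ * ev ≤ 1) (hS : 0 ≤ S)
    (hp : 0 < p) :
    ev ^ p * exp (-2 * (η₀ * ev) * S) ≤ exp 2 * p ^ p * η₀ ^ (-p) * (1 + S) ^ (-p) := by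
  have hy : 0 ≤ η₀ * ev * (1 + S) := by positivity
  have h2 := rpow_le_rpow_self_mul_exp hy hp
  have e1 : ev ^ p = η₀ ^ (-p) * (1 + S) ^ (-p) * (η₀ * ev * (1 + S)) ^ p := by
    rw [mul_rpow (by positivity) (by positivity), mul_rpow hη.le hev, rpow_neg hη.le,
      rpow_neg (by positivity)]
    field_simp
  -- The factor `2` in the decay absorbs the exponential loss: the total exponent is `η₀ ev (1 - S)
  -- ≤ 1`.
  have h3 : exp (η₀ * ev * (1 + S)) * exp (-2 * (η₀ * ev) * S) ≤ exp 2 := by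
    rw [← exp_add, exp_le_exp]
    nlinarith [mul_nonneg (mul_nonneg hη.le hev) hS]
  calc _ = η₀ ^ (-p) * (1 + S) ^ (-p) *
        ((η₀ * ev * (1 + S)) ^ p * exp (-2 * (η₀ * ev) * S)) := by rw [e1]; ring
    _ ≤ η₀ ^ (-p) * (1 + S) ^ (-p) *
        (p ^ p * exp (η₀ * ev * (1 + S)) * exp (-2 * (η₀ * ev) * S)) := by gcongr
    _ = η₀ ^ (-p) * (1 + S) ^ (-p) * p ^ p *
        (exp (η₀ * ev * (1 + S)) * exp (-2 * (η₀ * ev) * S)) := by ring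
    _ ≤ η₀ ^ (-p) * (1 + S) ^ (-p) * p ^ p * exp 2 := by gcongr
    _ = _ := by ring

/-- Unrolling of the coordinate recursion. -/
lemma le_of_coord_recursion {θ ev η₀ : ℝ} (hθ : 0 ≤ θ)
    (h1 : η₀ * ev ≤ 1) {B m : ℕ → ℝ} (hB : ∀ n, 0 ≤ B n)
    (hrec : ∀ n, B (n + 1) ≤ (1 - η₀ * stepSeq θ n * ev) ^ 2 * B n
      + (η₀ * stepSeq θ n) ^ 2 * ev ^ 2 * m n) (n : ℕ) :
    B n ≤ exp (-2 * (η₀ * ev) * stepSum θ 0 n) * B 0 +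
      ∑ k ∈ Finset.range n, (η₀ * stepSeq θ k) ^ 2 * ev ^ 2 * m k
        * exp (-2 * (η₀ * ev) * stepSum θ (k + 1) n) := by
  induction n with
  | zero => simp [stepSum_self]
  | succ n ih =>
    have h2 : (1 - η₀ * stepSeq θ n * ev) ^ 2 ≤ exp (-2 * (η₀ * ev) * stepSeq θ n) := by
      -- Nonnegativity, from the step size restriction, allows `1 - x ≤ e^{-x}` to be squared.
      have h3 : 0 ≤ 1 - η₀ * stepSeq θ n * ev := by
        have := mul_le_mul h1 (stepSeq_le_one hθ n) (stepSeq_pos θ n).le zero_le_one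
        nlinarith
      have h4 : 1 - η₀ * stepSeq θ n * ev ≤ exp (-(η₀ * stepSeq θ n * ev)) := by
        linarith [add_one_le_exp (-(η₀ * stepSeq θ n * ev))]
      calc _ ≤ exp (-(η₀ * stepSeq θ n * ev)) ^ 2 := by gcongr
        _ = _ := by rw [← exp_nat_mul]; congr 1; push_cast; ring
    have h5 : ∀ k ≤ n, exp (-2 * (η₀ * ev) * stepSum θ k (n + 1)) =
        exp (-2 * (η₀ * ev) * stepSeq θ n) * exp (-2 * (η₀ * ev) * stepSum θ k n) := fun k hk => by
      rw [stepSum_succ θ hk, ← exp_add]; congr 1; ring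
    rw [Finset.sum_range_succ, stepSum_self, mul_zero, exp_zero, mul_one, h5 0 (Nat.zero_le _),
      ← add_assoc]
    refine (hrec n).trans (add_le_add ?_ le_rfl)
    have h6 : ∑ k ∈ Finset.range n, (η₀ * stepSeq θ k) ^ 2 * ev ^ 2 * m k
          * exp (-2 * (η₀ * ev) * stepSum θ (k + 1) (n + 1)) =
        exp (-2 * (η₀ * ev) * stepSeq θ n) *
          ∑ k ∈ Finset.range n, (η₀ * stepSeq θ k) ^ 2 * ev ^ 2 * m k
            * exp (-2 * (η₀ * ev) * stepSum θ (k + 1) n) := by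
      rw [Finset.mul_sum]
      refine Finset.sum_congr rfl fun k hk => ?_
      rw [h5 (k + 1) (Finset.mem_range.1 hk)]
      ring
    rw [h6]
    calc _ ≤ exp (-2 * (η₀ * ev) * stepSeq θ n) * B n := by gcongr; exact hB n
      _ ≤ _ := (mul_le_mul_of_nonneg_left ih (exp_pos _).le).trans_eq (by ring)

/-- The weights of the accumulated noise. -/
noncomputable def noiseWeight (θ p : ℝ) (n : ℕ) : ℝ :=
  ∑ k ∈ Finset.range n, stepSeq θ k ^ 2 * (1 + stepSum θ (k + 1) n) ^ (-p)

lemma noiseWeight_nonneg (θ p : ℝ) (n : ℕ) : 0 ≤ noiseWeight θ p n :=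
  Finset.sum_nonneg fun k _ => by
    have := stepSum_nonneg θ (k + 1) n
    positivity

lemma stepSeq_sq (θ : ℝ) (k : ℕ) : stepSeq θ k ^ 2 = ((k : ℝ) + 1) ^ (-(2 * θ)) := by
  rw [stepSeq, ← rpow_natCast, ← rpow_mul (by positivity)]
  congr 1; push_cast; ring

/-- Split at `k + 1 = n / 2`. For early `k` the remaining step sum satisfies `1 + S ≥ n^{1-θ} / 2`;
for late `k` the squared step is at most `4 n^{-2θ}`. Both sums are then extended to all `k`. -/
lemma noiseWeight_le {θ p : ℝ} (hθ0 : 0 ≤ θ) (hθ1 : θ ≤ 1) (hp : 0 ≤ p) {n : ℕ} (hn : 1 ≤ n) :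
    noiseWeight θ p n ≤ 2 ^ p * ((n : ℝ) ^ (-((1 - θ) * p)) *
        ∑ k ∈ Finset.range n, ((k : ℝ) + 1) ^ (-(2 * θ)))
      + 4 * ((n : ℝ) ^ (-(2 * θ)) *
        ∑ j ∈ Finset.range n, (1 + (j : ℝ) * (n : ℝ) ^ (-θ)) ^ (-p)) := by
  have hn0 : (0 : ℝ) < n := by exact_mod_cast hn
  set δ := (n : ℝ) ^ (-θ) with hδ
  have hδ0 : 0 < δ := by positivity
  -- With `j = n - 1 - k`, the number of steps after step `k`, both sides are compared term by term.
  rw [← Finset.sum_range_reflect (fun j : ℕ => (1 + (j : ℝ) * δ) ^ (-p)), Finset.mul_sum,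
    Finset.mul_sum, Finset.mul_sum, Finset.mul_sum, ← Finset.sum_add_distrib, noiseWeight]
  refine Finset.sum_le_sum fun k hk => ?_
  have hk' : k + 1 ≤ n := Finset.mem_range.1 hk
  have hc : ((n - 1 - k : ℕ) : ℝ) = n - (k + 1) := by
    rw [Nat.sub_sub, add_comm 1 k, Nat.cast_sub hk']; push_cast; ring
  have hkr : (k : ℝ) + 1 ≤ n := by exact_mod_cast hk'
  have hS := le_stepSum hθ0 hk'
  push_cast at hS
  rw [hc, stepSeq_sq]
  have hS0 : 0 ≤ ((n : ℝ) - (k + 1)) * δ := mul_nonneg (by linarith) hδ0.le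
  have h1 : (1 + stepSum θ (k + 1) n) ^ (-p) ≤ (1 + ((n : ℝ) - (k + 1)) * δ) ^ (-p) :=
    rpow_le_rpow_of_nonpos (by linarith) (by linarith) (by linarith)
  have hk0 : (0 : ℝ) < (k : ℝ) + 1 := by positivity
  have hA : 0 ≤ 2 ^ p * ((n : ℝ) ^ (-((1 - θ) * p)) * ((k : ℝ) + 1) ^ (-(2 * θ))) := by positivity
  have hB : 0 ≤ 4 * ((n : ℝ) ^ (-(2 * θ)) * (1 + ((n : ℝ) - (k + 1)) * δ) ^ (-p)) := by positivity
  by_cases hcase : 2 * ((k : ℝ) + 1) ≤ n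
  · have h2 : (1 + ((n : ℝ) - (k + 1)) * δ) ^ (-p) ≤ 2 ^ p * (n : ℝ) ^ (-((1 - θ) * p)) := by
      have h3 : (n : ℝ) ^ (1 - θ) / 2 ≤ 1 + ((n : ℝ) - (k + 1)) * δ := by
        rw [sub_eq_add_neg, rpow_add hn0, rpow_one]
        have : (n : ℝ) / 2 * δ ≤ ((n : ℝ) - (k + 1)) * δ := by gcongr; linarith
        linarith
      calc _ ≤ ((n : ℝ) ^ (1 - θ) / 2) ^ (-p) :=
            rpow_le_rpow_of_nonpos (by positivity) h3 (by linarith)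
        _ = _ := by
          rw [div_rpow (by positivity) (by norm_num), ← rpow_mul hn0.le, rpow_neg (by norm_num : (0:ℝ) ≤ 2),
            div_inv_eq_mul, mul_comm]
          congr 2; ring
    calc _ ≤ ((k : ℝ) + 1) ^ (-(2 * θ)) * (2 ^ p * (n : ℝ) ^ (-((1 - θ) * p))) := by
          gcongr; exact h1.trans h2
      _ = 2 ^ p * ((n : ℝ) ^ (-((1 - θ) * p)) * ((k : ℝ) + 1) ^ (-(2 * θ))) := by ring
      _ ≤ _ := by linarith
  · have h2 : ((k : ℝ) + 1) ^ (-(2 * θ)) ≤ 4 * (n : ℝ) ^ (-(2 * θ)) := by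
      calc _ ≤ ((n : ℝ) / 2) ^ (-(2 * θ)) :=
            rpow_le_rpow_of_nonpos (by positivity) (by linarith) (by linarith)
        _ = 2 ^ (2 * θ) * (n : ℝ) ^ (-(2 * θ)) := by
          rw [div_rpow hn0.le (by norm_num), rpow_neg (by norm_num : (0:ℝ) ≤ 2), div_inv_eq_mul, mul_comm]
        _ ≤ 2 ^ (2 : ℝ) * (n : ℝ) ^ (-(2 * θ)) := by
          gcongr
          · norm_num
          · linarith
        _ = _ := by norm_num
    calc _ ≤ 4 * (n : ℝ) ^ (-(2 * θ)) * (1 + ((n : ℝ) - (k + 1)) * δ) ^ (-p) := by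
          have := stepSum_nonneg θ (k + 1) n
          gcongr
      _ = 4 * ((n : ℝ) ^ (-(2 * θ)) * (1 + ((n : ℝ) - (k + 1)) * δ) ^ (-p)) := by ring
      _ ≤ _ := by linarith

/-- Passing from left to right endpoints costs a constant and makes the telescoping bounds on
Riemann sums below applicable. -/
lemma one_add_mul_rpow_neg_le {δ p : ℝ} (hδ0 : 0 < δ) (hδ1 : δ ≤ 1) (hp : 0 ≤ p) (j : ℕ) :
    (1 + (j : ℝ) * δ) ^ (-p) ≤ 2 ^ p * (1 + ((j : ℝ) + 1) * δ) ^ (-p) := by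
  have hj : (0 : ℝ) ≤ j * δ := by positivity
  calc _ ≤ ((1 + ((j : ℝ) + 1) * δ) / 2) ^ (-p) :=
        rpow_le_rpow_of_nonpos (by positivity) (by nlinarith) (by linarith)
    _ = _ := by
      rw [div_rpow (by positivity) (by norm_num), rpow_neg (by norm_num : (0:ℝ) ≤ 2), div_inv_eq_mul,
        mul_comm]

lemma one_sub_div_le_log {x y : ℝ} (hx : 0 < x) (hy : 0 < y) : (y - x) / y ≤ log y - log x := by
  have := log_le_sub_one_of_pos (div_pos hx hy)
  rw [log_div hx.ne' hy.ne'] at this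
  rw [sub_div, div_self hy.ne']
  linarith

lemma sum_one_add_mul_inv_le {δ : ℝ} (hδ0 : 0 < δ) (n : ℕ) :
    δ * ∑ j ∈ Finset.range n, (1 + ((j : ℝ) + 1) * δ) ^ (-1 : ℝ) ≤ log (1 + (n : ℝ) * δ) := by
  induction n with
  | zero => simp
  | succ n ih =>
    rw [Finset.sum_range_succ, mul_add]
    have := one_sub_div_le_log (x := 1 + (n : ℝ) * δ) (y := 1 + ((n : ℝ) + 1) * δ)
      (by positivity) (by positivity)
    rw [rpow_neg_one, ← div_eq_mul_inv]
    push_cast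
    have e : 1 + ((n : ℝ) + 1) * δ - (1 + (n : ℝ) * δ) = δ := by ring
    rw [e] at this
    linarith

/-- The tangent inequality for the convex function `t ↦ t^{-q}` at `y`, obtained from `e^u ≥ 1 + u`
with `u = q log(y / x)`; the right side telescopes. -/
lemma rpow_neg_sub_rpow_neg_ge {x y q : ℝ} (hx : 0 < x) (hy : 0 < y) (hq : 0 ≤ q) :
    q * (y - x) * y ^ (-(q + 1)) ≤ x ^ (-q) - y ^ (-q) := by
  have h1 := one_sub_div_le_log hx hy
  have h2 := add_one_le_exp (q * (log y - log x))
  have e1 : x ^ (-q) = y ^ (-q) * exp (q * (log y - log x)) := by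
    rw [rpow_def_of_pos hx, rpow_def_of_pos hy, ← exp_add]; congr 1; ring
  have e2 : y ^ (-(q + 1)) = y ^ (-q) / y := by
    rw [neg_add, ← sub_eq_add_neg, rpow_sub_one hy.ne']
  have h3 : 0 < y ^ (-q) := by positivity
  rw [e1, e2]
  have h4 := mul_le_mul_of_nonneg_left h1 hq
  calc _ = y ^ (-q) * (q * ((y - x) / y)) := by ring
    _ ≤ y ^ (-q) * (exp (q * (log y - log x)) - 1) := by gcongr; linarith
    _ = _ := by ring

lemma sum_one_add_mul_rpow_neg_le {δ q : ℝ} (hδ0 : 0 < δ) (hq : 0 ≤ q) (n : ℕ) :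
    q * δ * ∑ j ∈ Finset.range n, (1 + ((j : ℝ) + 1) * δ) ^ (-(q + 1))
      ≤ 1 - (1 + (n : ℝ) * δ) ^ (-q) := by
  induction n with
  | zero => simp
  | succ n ih =>
    rw [Finset.sum_range_succ, mul_add]
    have := rpow_neg_sub_rpow_neg_ge (x := 1 + (n : ℝ) * δ) (y := 1 + ((n : ℝ) + 1) * δ)
      (by positivity) (by positivity) hq
    push_cast
    have e : 1 + ((n : ℝ) + 1) * δ - (1 + (n : ℝ) * δ) = δ := by ring
    rw [e] at this
    linarith

lemma sum_range_inv_le {n : ℕ} : ∑ k ∈ Finset.range n, ((k : ℝ) + 1)⁻¹ ≤ 1 + log n := by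
  have := harmonic_le_one_add_log n
  simpa [harmonic] using this

/-- Comparison with the harmonic sum treats `a = 1` and `a < 1` at once. The logarithm is
superfluous for `a < 1`, but harmless later. -/
lemma sum_range_rpow_neg_le {a : ℝ} (ha : a ≤ 1) {n : ℕ} (hn : 1 ≤ n) :
    ∑ k ∈ Finset.range n, ((k : ℝ) + 1) ^ (-a) ≤ (n : ℝ) ^ (1 - a) * (1 + log n) := by
  calc _ ≤ ∑ k ∈ Finset.range n, (n : ℝ) ^ (1 - a) * ((k : ℝ) + 1)⁻¹ := by
        refine Finset.sum_le_sum fun k hk => ?_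
        have hk' : (k : ℝ) + 1 ≤ n := by exact_mod_cast Finset.mem_range.1 hk
        have hk0 : (0 : ℝ) < (k : ℝ) + 1 := by positivity
        have : ((k : ℝ) + 1) ^ (-a) = ((k : ℝ) + 1) ^ (1 - a) * ((k : ℝ) + 1)⁻¹ := by
          rw [← rpow_neg_one, ← rpow_add hk0]; congr 1; ring
        rw [this]
        gcongr
    _ ≤ _ := by
      rw [← Finset.mul_sum]
      gcongr
      exact sum_range_inv_le

end Scalar

/-! ### Convergence rates of the bias and of the accumulated noise. -/

section Rates

open Real

/-- The convergence rate `(n+1)^{-θ}`, with an extra logarithm when `s = 1`. -/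
noncomputable def rate (θ s : ℝ) (n : ℕ) : ℝ :=
  if s < 1 then ((n : ℝ) + 1) ^ (-θ) else ((n : ℝ) + 1) ^ (-θ) * log ((n : ℝ) + 1)

lemma log_add_one_ge {n : ℕ} (hn : 1 ≤ n) : log 2 ≤ log ((n : ℝ) + 1) := by
  have : (1 : ℝ) ≤ n := by exact_mod_cast hn
  exact log_le_log (by norm_num) (by linarith)

lemma rpow_neg_le_two_mul {θ : ℝ} (hθ0 : 0 ≤ θ) (hθ1 : θ ≤ 1) {n : ℕ} (hn : 1 ≤ n) :
    (n : ℝ) ^ (-θ) ≤ 2 * ((n : ℝ) + 1) ^ (-θ) := by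
  have hn1 : (1 : ℝ) ≤ n := by exact_mod_cast hn
  calc _ ≤ (((n : ℝ) + 1) / 2) ^ (-θ) :=
        rpow_le_rpow_of_nonpos (by positivity) (by linarith) (by linarith)
    _ = 2 ^ θ * ((n : ℝ) + 1) ^ (-θ) := by
      rw [div_rpow (by positivity) (by norm_num), rpow_neg (by norm_num : (0:ℝ) ≤ 2), div_inv_eq_mul,
        mul_comm]
    _ ≤ 2 ^ (1 : ℝ) * ((n : ℝ) + 1) ^ (-θ) := by
      gcongr
      norm_num
    _ = _ := by norm_num

lemma rpow_neg_le_rate {θ s : ℝ} {n : ℕ} (hn : 1 ≤ n) :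
    ((n : ℝ) + 1) ^ (-θ) ≤ (log 2)⁻¹ * rate θ s n := by
  have h2 : 0 < log 2 := log_pos (by norm_num)
  have h3 : log 2 ≤ 1 := by linarith [log_two_lt_d9]
  have h4 := log_add_one_ge hn
  have h5 : (0 : ℝ) ≤ ((n : ℝ) + 1) ^ (-θ) := by positivity
  rw [← div_eq_inv_mul, le_div_iff₀ h2, rate]
  split_ifs
  · nlinarith
  · gcongr

lemma rate_nonneg (θ s : ℝ) (n : ℕ) : 0 ≤ rate θ s n := by
  have : 0 ≤ log ((n : ℝ) + 1) := log_nonneg (by linarith [n.cast_nonneg (α := ℝ)])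
  unfold rate
  split_ifs <;> positivity

lemma rate_le {θ s : ℝ} (hθ : 0 < θ) (n : ℕ) : rate θ s n ≤ 1 + θ⁻¹ := by
  have h0 : (0 : ℝ) < θ⁻¹ := by positivity
  have h1 : (1 : ℝ) ≤ (n : ℝ) + 1 := by linarith [n.cast_nonneg (α := ℝ)]
  unfold rate
  split_ifs
  · have := rpow_le_one_of_one_le_of_nonpos h1 (by linarith : -θ ≤ 0)
    linarith
  · have h2 := log_le_rpow_div (by linarith : (0 : ℝ) ≤ (n : ℝ) + 1) hθ
    have h3 : ((n : ℝ) + 1) ^ (-θ) * log ((n : ℝ) + 1) ≤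
        ((n : ℝ) + 1) ^ (-θ) * (((n : ℝ) + 1) ^ θ / θ) := by gcongr
    have h4 : ((n : ℝ) + 1) ^ (-θ) * ((n : ℝ) + 1) ^ θ = 1 := by
      rw [← rpow_add (by linarith), neg_add_cancel, rpow_zero]
    have h5 : ((n : ℝ) + 1) ^ (-θ) * (((n : ℝ) + 1) ^ θ / θ) = θ⁻¹ := by
      rw [mul_div_assoc', h4, one_div]
    linarith

lemma rpow_neg_mul_one_add_log_le {θ : ℝ} (hθ0 : 0 ≤ θ) (hθ1 : θ ≤ 1) {n : ℕ} (hn : 1 ≤ n) :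
    (n : ℝ) ^ (-θ) * (1 + log ((n : ℝ) + 1)) ≤ 2 * ((log 2)⁻¹ + 1) * rate θ 1 n := by
  have h2 : 0 < log 2 := log_pos (by norm_num)
  have h4 := log_add_one_ge hn
  have h5 : 1 + log ((n : ℝ) + 1) ≤ ((log 2)⁻¹ + 1) * log ((n : ℝ) + 1) := by
    have : 1 ≤ (log 2)⁻¹ * log ((n : ℝ) + 1) := by
      rw [← div_eq_inv_mul, le_div_iff₀ h2]; linarith
    linarith
  rw [rate, if_neg (lt_irrefl _)]
  calc _ ≤ (2 * ((n : ℝ) + 1) ^ (-θ)) * (((log 2)⁻¹ + 1) * log ((n : ℝ) + 1)) := by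
        refine mul_le_mul (rpow_neg_le_two_mul hθ0 hθ1 hn) h5 ?_ (by positivity)
        linarith
    _ = _ := by ring

/-- The early steps contribute at the optimal rate. -/
lemma exists_sum_rpow_le {θ s : ℝ} (hθ0 : 0 < θ) (hθ1 : θ < 1) (hs1 : s ≤ 1)
    (hθs : θ ≤ (1 - θ) * (2 - s)) :
    ∃ D : ℝ, 0 ≤ D ∧ ∀ n : ℕ, 1 ≤ n → (n : ℝ) ^ (-((1 - θ) * (2 - s))) *
      ∑ k ∈ Finset.range n, ((k : ℝ) + 1) ^ (-(2 * θ)) ≤ D * rate θ s n := by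
  have hl2 : 0 < log 2 := log_pos (by norm_num)
  rcases lt_or_ge 1 (2 * θ) with h | h
  · have hsum : Summable fun k : ℕ => ((k : ℝ) + 1) ^ (-(2 * θ)) := by
      have := (summable_nat_add_iff 1).2 (summable_nat_rpow.2 (by linarith : -(2 * θ) < -1))
      simpa using this
    set Z := ∑' k : ℕ, ((k : ℝ) + 1) ^ (-(2 * θ)) with hZ
    have hZ0 : 0 ≤ Z := tsum_nonneg fun k => by positivity
    refine ⟨2 * Z * (log 2)⁻¹, by positivity, fun n hn => ?_⟩
    have hn1 : (1 : ℝ) ≤ n := by exact_mod_cast hn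
    have h1 : ∑ k ∈ Finset.range n, ((k : ℝ) + 1) ^ (-(2 * θ)) ≤ Z :=
      hsum.sum_le_tsum _ fun k _ => by positivity
    calc _ ≤ (n : ℝ) ^ (-θ) * Z := by
          gcongr
      _ ≤ (2 * ((log 2)⁻¹ * rate θ s n)) * Z := by
          gcongr
          exact (rpow_neg_le_two_mul hθ0.le hθ1.le hn).trans
            (by gcongr; exact rpow_neg_le_rate hn)
      _ = _ := by ring
  · rcases hs1.lt_or_eq with hs | rfl
    · set ε := (1 - s) * (1 - θ) with hε
      have hε0 : 0 < ε := mul_pos (by linarith) (by linarith)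
      refine ⟨2 * (1 + ε⁻¹) * (log 2)⁻¹, by positivity, fun n hn => ?_⟩
      have hn1 : (1 : ℝ) ≤ n := by exact_mod_cast hn
      have hn0 : (0 : ℝ) < n := by linarith
      have h1 := sum_range_rpow_neg_le h hn
      have h2 : 1 + log n ≤ (n : ℝ) ^ ε * (1 + ε⁻¹) := by
        have h3 := log_le_rpow_div hn0.le hε0
        have h4 : 1 ≤ (n : ℝ) ^ ε := one_le_rpow hn1 hε0.le
        rw [mul_add, mul_one, ← div_eq_mul_inv]
        linarith
      calc _ ≤ (n : ℝ) ^ (-((1 - θ) * (2 - s))) *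
            ((n : ℝ) ^ (1 - 2 * θ) * ((n : ℝ) ^ ε * (1 + ε⁻¹))) := by
            gcongr
            exact h1.trans (by gcongr)
        _ = (n : ℝ) ^ (-θ) * (1 + ε⁻¹) := by
            rw [← mul_assoc, ← mul_assoc, ← rpow_add hn0, ← rpow_add hn0]
            congr 2
            rw [hε]; ring
        _ ≤ (2 * ((log 2)⁻¹ * rate θ s n)) * (1 + ε⁻¹) := by
            gcongr
            exact (rpow_neg_le_two_mul hθ0.le hθ1.le hn).trans
              (by gcongr; exact rpow_neg_le_rate hn)
        _ = _ := by ring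
    · refine ⟨2 * ((log 2)⁻¹ + 1), by positivity, fun n hn => ?_⟩
      have hn1 : (1 : ℝ) ≤ n := by exact_mod_cast hn
      have hn0 : (0 : ℝ) < n := by linarith
      have h1 := sum_range_rpow_neg_le h hn
      calc _ ≤ (n : ℝ) ^ (-((1 - θ) * (2 - 1))) * ((n : ℝ) ^ (1 - 2 * θ) * (1 + log n)) := by
            gcongr
        _ = (n : ℝ) ^ (-θ) * (1 + log n) := by
            rw [← mul_assoc, ← rpow_add hn0]
            congr 2
            ring
        _ ≤ (n : ℝ) ^ (-θ) * (1 + log ((n : ℝ) + 1)) := by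
            gcongr
            linarith
        _ ≤ _ := rpow_neg_mul_one_add_log_le hθ0.le hθ1.le hn

/-- The late steps contribute at the optimal rate. -/
lemma exists_sum_one_add_rpow_le {θ s : ℝ} (hθ0 : 0 < θ) (hθ1 : θ < 1) (hs1 : s ≤ 1) :
    ∃ D : ℝ, 0 ≤ D ∧ ∀ n : ℕ, 1 ≤ n → (n : ℝ) ^ (-(2 * θ)) *
      ∑ j ∈ Finset.range n, (1 + (j : ℝ) * (n : ℝ) ^ (-θ)) ^ (-(2 - s)) ≤ D * rate θ s n := by
  have hl2 : 0 < log 2 := log_pos (by norm_num)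
  have hsplit : ∀ n : ℕ, 1 ≤ n → (n : ℝ) ^ (-(2 * θ)) *
      ∑ j ∈ Finset.range n, (1 + (j : ℝ) * (n : ℝ) ^ (-θ)) ^ (-(2 - s)) ≤
      2 ^ (2 - s) * ((n : ℝ) ^ (-θ) * ((n : ℝ) ^ (-θ) *
        ∑ j ∈ Finset.range n, (1 + ((j : ℝ) + 1) * (n : ℝ) ^ (-θ)) ^ (-(2 - s)))) := by
    intro n hn
    have hn1 : (1 : ℝ) ≤ n := by exact_mod_cast hn
    have hn0 : (0 : ℝ) < n := by linarith
    have e : (n : ℝ) ^ (-(2 * θ)) = (n : ℝ) ^ (-θ) * (n : ℝ) ^ (-θ) := by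
      rw [← rpow_add hn0]; congr 1; ring
    calc _ ≤ (n : ℝ) ^ (-(2 * θ)) * ∑ j ∈ Finset.range n,
          2 ^ (2 - s) * (1 + ((j : ℝ) + 1) * (n : ℝ) ^ (-θ)) ^ (-(2 - s)) := by
          gcongr with j _
          exact one_add_mul_rpow_neg_le (by positivity)
            (rpow_le_one_of_one_le_of_nonpos hn1 (by linarith)) (by linarith) j
      _ = _ := by rw [← Finset.mul_sum, e]; ring
  -- With mesh `δ = n^{-θ}`, what remains is a Riemann sum of `(1+t)^{-(2-s)}` over `[0, nδ]`: at
  -- most `1/(1-s)` for `s < 1`, and logarithmic for `s = 1`.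
  rcases hs1.lt_or_eq with hs | rfl
  · have hq : 0 < 1 - s := by linarith
    refine ⟨2 ^ (2 - s) * (2 * (log 2)⁻¹) * (1 - s)⁻¹, by positivity, fun n hn => ?_⟩
    have hn1 : (1 : ℝ) ≤ n := by exact_mod_cast hn
    have hn0 : (0 : ℝ) < n := by linarith
    have h1 := sum_one_add_mul_rpow_neg_le (δ := (n : ℝ) ^ (-θ)) (by positivity) hq.le n
    have h2 : (n : ℝ) ^ (-θ) * ∑ j ∈ Finset.range n,
        (1 + ((j : ℝ) + 1) * (n : ℝ) ^ (-θ)) ^ (-(2 - s)) ≤ (1 - s)⁻¹ := by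
      rw [← one_div, le_div_iff₀ hq]
      have : (0 : ℝ) ≤ (1 + (n : ℝ) * (n : ℝ) ^ (-θ)) ^ (-(1 - s)) := by positivity
      have e : -(1 - s + 1) = -(2 - s) := by ring
      rw [e] at h1
      linarith
    refine (hsplit n hn).trans ?_
    calc _ ≤ 2 ^ (2 - s) * ((2 * ((log 2)⁻¹ * rate θ s n)) * (1 - s)⁻¹) := by
          have := rate_nonneg θ s n
          gcongr
          exact (rpow_neg_le_two_mul hθ0.le hθ1.le hn).trans
            (by gcongr; exact rpow_neg_le_rate hn)
      _ = _ := by ring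
  · refine ⟨2 ^ (2 - 1 : ℝ) * (2 * ((log 2)⁻¹ + 1)), by positivity, fun n hn => ?_⟩
    have hn1 : (1 : ℝ) ≤ n := by exact_mod_cast hn
    have hn0 : (0 : ℝ) < n := by linarith
    have h1 := sum_one_add_mul_inv_le (δ := (n : ℝ) ^ (-θ)) (by positivity) n
    have h2 : log (1 + (n : ℝ) * (n : ℝ) ^ (-θ)) ≤ 1 + log ((n : ℝ) + 1) := by
      have : (n : ℝ) * (n : ℝ) ^ (-θ) ≤ n * 1 := by
        gcongr
        exact rpow_le_one_of_one_le_of_nonpos hn1 (by linarith)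
      have := log_le_log (by positivity) (by linarith : 1 + (n : ℝ) * (n : ℝ) ^ (-θ) ≤ n + 1)
      linarith
    refine (hsplit n hn).trans ?_
    rw [mul_assoc (2 ^ (2 - 1 : ℝ))]
    refine mul_le_mul_of_nonneg_left ?_ (by positivity)
    refine le_trans ?_ (rpow_neg_mul_one_add_log_le hθ0.le hθ1.le hn)
    refine mul_le_mul_of_nonneg_left ?_ (by positivity)
    have e : (-(2 - 1) : ℝ) = -1 := by norm_num
    rw [e]
    exact h1.trans h2

lemma exists_noiseWeight_le {θ s : ℝ} (hθ0 : 0 < θ) (hθ1 : θ < 1) (hs1 : s ≤ 1)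
    (hθs : θ ≤ (1 - θ) * (2 - s)) :
    ∃ D : ℝ, 0 ≤ D ∧ ∀ n : ℕ, 1 ≤ n → noiseWeight θ (2 - s) n ≤ D * rate θ s n := by
  obtain ⟨D₁, h1, H1⟩ := exists_sum_rpow_le hθ0 hθ1 hs1 hθs
  obtain ⟨D₂, h2, H2⟩ := exists_sum_one_add_rpow_le hθ0 hθ1 hs1
  refine ⟨2 ^ (2 - s) * D₁ + 4 * D₂, by positivity, fun n hn => ?_⟩
  refine (noiseWeight_le hθ0.le hθ1.le (by linarith) hn).trans ?_
  have h3 := mul_le_mul_of_nonneg_left (H1 n hn) (by positivity : (0 : ℝ) ≤ 2 ^ (2 - s))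
  have h4 := mul_le_mul_of_nonneg_left (H2 n hn) (by norm_num : (0 : ℝ) ≤ 4)
  calc _ ≤ _ := add_le_add h3 h4
    _ = _ := by ring

lemma one_add_stepSum_rpow_le_one {θ p : ℝ} (hp : 0 ≤ p) (k n : ℕ) :
    (1 + stepSum θ k n) ^ (-p) ≤ 1 :=
  rpow_le_one_of_one_le_of_nonpos (by linarith [stepSum_nonneg θ k n]) (by linarith)

lemma one_add_stepSum_rpow_le_rate {θ p s : ℝ} (hθ0 : 0 < θ) (hθ1 : θ < 1)
    (hp : 0 ≤ p) (hθp : θ ≤ (1 - θ) * p) {n : ℕ} (hn : 1 ≤ n) :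
    (1 + stepSum θ 0 n) ^ (-p) ≤ 2 * (log 2)⁻¹ * rate θ s n := by
  have hn1 : (1 : ℝ) ≤ n := by exact_mod_cast hn
  have hn0 : (0 : ℝ) < n := by linarith
  have h1 := le_stepSum hθ0.le (Nat.zero_le n)
  rw [Nat.cast_zero, sub_zero] at h1
  have e : (n : ℝ) * (n : ℝ) ^ (-θ) = (n : ℝ) ^ (1 - θ) := by
    rw [sub_eq_add_neg, rpow_add hn0, rpow_one]
  rw [e] at h1
  calc _ ≤ ((n : ℝ) ^ (1 - θ)) ^ (-p) :=
        rpow_le_rpow_of_nonpos (by positivity) (by linarith) (by linarith)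
    _ = (n : ℝ) ^ (-((1 - θ) * p)) := by rw [← rpow_mul hn0.le]; congr 1; ring
    _ ≤ (n : ℝ) ^ (-θ) := rpow_le_rpow_of_exponent_le hn1 (by linarith)
    _ ≤ 2 * ((log 2)⁻¹ * rate θ s n) := (rpow_neg_le_two_mul hθ0.le hθ1.le hn).trans
        (by gcongr; exact rpow_neg_le_rate hn)
    _ = _ := by ring

/-- A discrete Gronwall argument: if the noise feedback is weak then the sequence is bounded. -/
lemma le_of_weak_feedback {θ p q A Q c v W : ℝ} (hp : 0 ≤ p) (hA : 0 ≤ A)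
    (hQ : 0 ≤ Q) (hc : 0 ≤ c) (hv : 0 ≤ v) (hW : ∀ n, noiseWeight θ q n ≤ W)
    (hQW : Q * c * W ≤ 1 / 2) {a : ℕ → ℝ}
    (ha : ∀ n, a n ≤ A * (1 + stepSum θ 0 n) ^ (-p) +
      Q * ∑ k ∈ Finset.range n,
        stepSeq θ k ^ 2 * (1 + stepSum θ (k + 1) n) ^ (-q) * (c * a k + v)) (n : ℕ) :
    a n ≤ A * (1 + stepSum θ 0 n) ^ (-p) +
      Q * (c * (2 * (A + Q * v * W)) + v) * noiseWeight θ q n := by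
  have hW0 : 0 ≤ W := (noiseWeight_nonneg θ q 0).trans (hW 0)
  -- `B` solves `A + Q v W + B / 2 = B`, so a feedback coefficient at most `1/2` preserves the bound
  -- `a k ≤ B`.
  set B := 2 * (A + Q * v * W) with hB
  have hB0 : 0 ≤ B := by positivity
  have hstep : ∀ n, (∀ k < n, a k ≤ B) → a n ≤ A * (1 + stepSum θ 0 n) ^ (-p) +
      Q * (c * B + v) * noiseWeight θ q n := by
    intro n ih
    refine (ha n).trans (add_le_add le_rfl ?_)
    rw [mul_assoc]
    refine mul_le_mul_of_nonneg_left ?_ hQ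
    rw [noiseWeight, Finset.mul_sum]
    refine Finset.sum_le_sum fun k hk => ?_
    rw [mul_comm (c * B + v)]
    have h0 := stepSum_nonneg θ (k + 1) n
    gcongr
    exact ih k (Finset.mem_range.1 hk)
  -- `hstep` serves twice: once to turn the uniform bound into the decaying one, and by strong
  -- induction to prove the uniform bound.
  refine hstep n fun k _ => ?_
  induction k using Nat.strong_induction_on with
  | _ k ih =>
    refine (hstep k fun j hj => ih j hj (by omega)).trans ?_
    calc _ ≤ A * 1 + Q * (c * B + v) * W := by
          gcongr
          · exact one_add_stepSum_rpow_le_one hp 0 k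
          · exact hW k
      _ = A + Q * v * W + (Q * c * W) * B := by ring
      _ ≤ A + Q * v * W + 1 / 2 * B := by gcongr
      _ = B := by rw [hB]; ring

end Rates

/-! ### From coordinates to the full error. -/

section Assembly

variable {d : ℕ} {Ω : Type*} [MeasurableSpace Ω] {P : Measure Ω} [IsProbabilityMeasure P]
  {M : FunctionalLinearModel d P} {Ω' : Type*} [MeasurableSpace Ω'] {P' : Measure Ω'}
  [IsProbabilityMeasure P'] {K : ReproducingKernel d} {x : ℕ → Ω' → L2 d} {y : ℕ → Ω' → ℝ}
  {η : ℕ → ℝ} {β : ℕ → Ω' → L2 d}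

-- Parseval and Tonelli for series of nonnegative terms, so that only finite sets of coordinates
-- need to be estimated.
omit [IsProbabilityMeasure P'] in
lemma integral_norm_sq_le_of_coord {ι : Type*} (b : HilbertBasis ι ℝ (L2 d)) {F : Ω' → L2 d}
    (hF : MemLp F 2 P') {R : ℝ}
    (h : ∀ J : Finset ι, ∑ i ∈ J, ∫ ω, (inner ℝ (F ω) (b i)) ^ 2 ∂P' ≤ R) :
    ∫ ω, ‖F ω‖ ^ 2 ∂P' ≤ R := by
  have := HilbertBasis.countable_index b
  have hR : 0 ≤ R := by simpa using h ∅
  have hi : ∀ i, Integrable (fun ω => (inner ℝ (F ω) (b i) : ℝ) ^ 2) P' := fun i => by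
    refine MemLp.integrable_sq (((innerSL ℝ (b i)).comp_memLp' hF).ae_eq
      (Filter.Eventually.of_forall fun ω => ?_))
    simp [real_inner_comm]
  have hpars : ∀ f : L2 d, ENNReal.ofReal (‖f‖ ^ 2) = ∑' i, ENNReal.ofReal (inner ℝ f (b i) ^ 2) := by
    intro f
    have h1 := b.hasSum_inner_mul_inner f f
    have e : ∀ i, (inner ℝ f (b i) : ℝ) * inner ℝ (b i) f = inner ℝ f (b i) ^ 2 := fun i => by
      rw [real_inner_comm f (b i), sq]
    simp only [e, real_inner_self_eq_norm_sq] at h1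
    rw [← h1.tsum_eq, ENNReal.ofReal_tsum_of_nonneg (fun i => sq_nonneg _) h1.summable]
  rw [← ENNReal.ofReal_le_ofReal_iff hR,
    ofReal_integral_eq_lintegral_ofReal (hF.integrable_norm_pow (by norm_num))
      (Filter.Eventually.of_forall fun ω => sq_nonneg _)]
  simp only [hpars]
  rw [lintegral_tsum fun i => (hi i).aestronglyMeasurable.aemeasurable.ennreal_ofReal,
    ENNReal.tsum_eq_iSup_sum]
  refine iSup_le fun J => ?_
  have e : ∀ i, ∫⁻ ω, ENNReal.ofReal (inner ℝ (F ω) (b i) ^ 2) ∂P'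
      = ENNReal.ofReal (∫ ω, inner ℝ (F ω) (b i) ^ 2 ∂P') := fun i =>
    (ofReal_integral_eq_lintegral_ofReal (hi i)
      (Filter.Eventually.of_forall fun ω => sq_nonneg _)).symm
  simp only [e]
  rw [← ENNReal.ofReal_sum_of_nonneg fun i _ => integral_nonneg fun ω => sq_nonneg _]
  exact ENNReal.ofReal_le_ofReal (h J)

lemma sum_rpow_le_opTrace_toReal {E : Type*} [NormedAddCommGroup E] [InnerProductSpace ℝ E]
    [CompleteSpace E] {A : E →L[ℝ] E} (hA : A.IsPositive) {ι : Type*}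
    (b : HilbertBasis ι ℝ E) {ev : ι → ℝ} (hb : ∀ i, A (b i) = ev i • b i) {s : ℝ} (hs : 0 < s)
    (hfin : opTrace (opPow A s) < ⊤) (J : Finset ι) :
    ∑ i ∈ J, ev i ^ s ≤ (opTrace (opPow A s)).toReal := by
  have h0 : ∀ i, 0 ≤ ev i := fun i =>
    IsPositive.eigenvalue_nonneg hA (hb i) (b.orthonormal.ne_zero i)
  rw [← ENNReal.ofReal_le_iff_le_toReal hfin.ne,
    ENNReal.ofReal_sum_of_nonneg fun i _ => Real.rpow_nonneg (h0 i) s]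
  exact (ENNReal.sum_le_tsum J).trans (tsum_rpow_le_opTrace hA b hb hs)

/-- Bound on a coordinate whose squared initial value satisfies the source condition. -/
lemma coord_le {r s θ ev η₀ G : ℝ} (hr : 0 < r) (hs1 : s ≤ 1) (hθ : 0 ≤ θ)
    (hη₀ : 0 < η₀) (hev : 0 ≤ ev) (h1 : η₀ * ev ≤ 1) {B m : ℕ → ℝ} (hm0 : ∀ k, 0 ≤ m k)
    (hB : ∀ n, 0 ≤ B n) (hB0 : B 0 = ev ^ (2 * r) * G ^ 2)
    (hrec : ∀ n, B (n + 1) ≤ (1 - η₀ * stepSeq θ n * ev) ^ 2 * B n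
      + (η₀ * stepSeq θ n) ^ 2 * ev ^ 2 * m n) (n : ℕ) :
    B n ≤ Real.exp 2 * (2 * r) ^ (2 * r) * η₀ ^ (-(2 * r)) * (1 + stepSum θ 0 n) ^ (-(2 * r))
        * G ^ 2 +
      (Real.exp 2 * (2 - s) ^ (2 - s) * η₀ ^ s * ∑ k ∈ Finset.range n, stepSeq θ k ^ 2 *
        (1 + stepSum θ (k + 1) n) ^ (-(2 - s)) * m k) * ev ^ s := by
  refine (le_of_coord_recursion hθ h1 hB hrec n).trans (add_le_add ?_ ?_)
  · rw [hB0]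
    have h5 := rpow_mul_exp_le hev hη₀ h1 (stepSum_nonneg θ 0 n) (by positivity : 0 < 2 * r)
    calc _ = (ev ^ (2 * r) * Real.exp (-2 * (η₀ * ev) * stepSum θ 0 n)) * G ^ 2 := by ring
      _ ≤ _ := mul_le_mul_of_nonneg_right h5 (sq_nonneg _)
  · rw [Finset.mul_sum, Finset.sum_mul]
    refine Finset.sum_le_sum fun k _ => ?_
    have h5 := rpow_mul_exp_le hev hη₀ h1 (stepSum_nonneg θ (k + 1) n)
      (by linarith : 0 < 2 - s)
    -- The exponential decay consumes `ev ^ (2 - s)`, and `ev ^ s` is left for the trace.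
    -- Correspondingly `η₀² η₀^{-(2-s)} = η₀ ^ s`, the small factor that weakens the feedback.
    have e1 : ev ^ 2 = ev ^ s * ev ^ (2 - s) := by
      rw [← Real.rpow_add' hev (by norm_num), add_sub_cancel]
      norm_num
    have e2 : η₀ ^ s = η₀ ^ 2 * η₀ ^ (-(2 - s)) := by
      rw [← Real.rpow_natCast η₀ 2, ← Real.rpow_add hη₀]
      congr 1; push_cast; ring
    have hk := hm0 k
    calc _ = η₀ ^ 2 * stepSeq θ k ^ 2 * m k * ev ^ s *
          (ev ^ (2 - s) * Real.exp (-2 * (η₀ * ev) * stepSum θ (k + 1) n)) := by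
          rw [e1]; ring
      _ ≤ η₀ ^ 2 * stepSeq θ k ^ 2 * m k * ev ^ s * (Real.exp 2 * (2 - s) ^ (2 - s)
          * η₀ ^ (-(2 - s)) * (1 + stepSum θ (k + 1) n) ^ (-(2 - s))) :=
        mul_le_mul_of_nonneg_left h5 (by positivity)
      _ = _ := by rw [e2]; ring

lemma sum_noise_nonneg (θ s : ℝ) {m : ℕ → ℝ} (hm : ∀ k, 0 ≤ m k) (n : ℕ) :
    0 ≤ ∑ k ∈ Finset.range n, stepSeq θ k ^ 2 * (1 + stepSum θ (k + 1) n) ^ (-(2 - s)) * m k :=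
  Finset.sum_nonneg fun k _ => by
    have := stepSum_nonneg θ (k + 1) n
    have := hm k
    positivity

lemma sum_le_of_le_add {ι : Type*} {J : Finset ι} {f u w : ι → ℝ} {a e U V : ℝ} (ha : 0 ≤ a)
    (he : 0 ≤ e) (h : ∀ i, f i ≤ a * u i + e * w i) (hu : ∑ i ∈ J, u i ≤ U)
    (hw : ∑ i ∈ J, w i ≤ V) : ∑ i ∈ J, f i ≤ a * U + e * V := by
  refine (Finset.sum_le_sum fun i _ => h i).trans ?_
  rw [Finset.sum_add_distrib, ← Finset.mul_sum, ← Finset.mul_sum]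
  gcongr

/-- As `β̂₁ = 0`, the initial error is `-L_C^{1/2} β⋆`, which the source condition makes explicit in
the eigenbasis. -/
lemma integral_coord_sq_init {r : ℝ} (hr : 0 < r) {g φ : L2 d} {ev : ℝ} (h0 : 0 ≤ ev)
    (hφ : M.mixedOp K φ = ev • φ) (hreg : M.Regularity K r g)
    (hβ : ∀ t ω, β t ω = sgd K η (fun k => x k ω) (fun k => y k ω) t) :
    ∫ ω, (inner ℝ (M.sqrtCov (β 1 ω - M.slope)) φ) ^ 2 ∂P' = ev ^ (2 * r) * inner ℝ g φ ^ 2 := by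
  have hβ1 : ∀ ω, β 1 ω = 0 := fun ω => hβ 1 ω
  have hpos := M.isPositive_mixedOp K
  have h3 : inner ℝ (M.sqrtCov M.slope) φ = ev ^ r * inner ℝ g φ := by
    have hreg' : M.sqrtCov M.slope = opPow (M.mixedOp K) r g := hreg
    rw [hreg', inner_opPow_left hpos hr.le, opPow_apply_eigenvector hpos hr.le hφ,
      inner_smul_right]
  have h4 : ev ^ (2 * r) = (ev ^ r) ^ 2 := by
    rw [← Real.rpow_natCast, ← Real.rpow_mul h0]
    congr 1; push_cast; ring
  simp only [hβ1, zero_sub, map_neg, inner_neg_left, h3]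
  rw [integral_const, probReal_univ, one_smul, neg_sq, mul_pow, h4]

/-- The mean square error of the iterates, in terms of the past mean square errors. -/
lemma integral_norm_sq_le {r s c η₀ θ : ℝ} {g : L2 d} (hr : 0 < r) (hs0 : 0 < s) (hs1 : s ≤ 1)
    (hc : 0 ≤ c) (hθ : 0 ≤ θ) (hη₀ : 0 < η₀) (hη₁ : η₀ * K.kappa ^ 2 ≤ 1)
    (htr : opTrace (opPow (M.mixedOp K) s) < ⊤) (hM : M.MomentCondition c)
    (hreg : M.Regularity K r g) (hS : M.IsSample P' x y)
    (hη : ∀ n, η (n + 1) = η₀ * stepSeq θ n)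
    (hβ : ∀ t ω, β t ω = sgd K η (fun k => x k ω) (fun k => y k ω) t) (n : ℕ) :
    ∫ ω, ‖M.sqrtCov (β (n + 1) ω - M.slope)‖ ^ 2 ∂P' ≤
      Real.exp 2 * (2 * r) ^ (2 * r) * η₀ ^ (-(2 * r)) * ‖g‖ ^ 2
        * (1 + stepSum θ 0 n) ^ (-(2 * r)) +
      Real.exp 2 * (2 - s) ^ (2 - s) * η₀ ^ s * (opTrace (opPow (M.mixedOp K) s)).toReal *
        ∑ k ∈ Finset.range n, stepSeq θ k ^ 2 * (1 + stepSum θ (k + 1) n) ^ (-(2 - s)) *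
          (c * ∫ ω, ‖M.sqrtCov (β (k + 1) ω - M.slope)‖ ^ 2 ∂P' + Var[M.noise; P]) := by
  have hpos := M.isPositive_mixedOp K
  obtain ⟨ι, b, ev, hb⟩ := exists_hilbertBasis_eigenvectors hpos (M.isCompactOperator_mixedOp K)
  have h0 : ∀ i, 0 ≤ ev i := fun i =>
    IsPositive.eigenvalue_nonneg hpos (hb i) (b.orthonormal.ne_zero i)
  have h1 : ∀ i, η₀ * ev i ≤ 1 := fun i => by
    have h2 := (M.mixedOp K).le_opNorm (b i)
    rw [hb, norm_smul, b.orthonormal.1, mul_one, mul_one, Real.norm_of_nonneg (h0 i)] at h2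
    exact (mul_le_mul_of_nonneg_left (h2.trans (M.norm_mixedOp_le K)) hη₀.le).trans hη₁
  set m : ℕ → ℝ := fun k =>
    c * ∫ ω, ‖M.sqrtCov (β (k + 1) ω - M.slope)‖ ^ 2 ∂P' + Var[M.noise; P] with hm
  have hm0 : ∀ k, 0 ≤ m k := fun k =>
    add_nonneg (mul_nonneg hc (integral_nonneg fun ω => sq_nonneg _)) (variance_nonneg _ _)
  set B : ι → ℕ → ℝ := fun i k =>
    ∫ ω, (inner ℝ (M.sqrtCov (β (k + 1) ω - M.slope)) (b i)) ^ 2 ∂P' with hB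
  have hB0 : ∀ i, B i 0 = ev i ^ (2 * r) * inner ℝ g (b i) ^ 2 := fun i =>
    integral_coord_sq_init hr (h0 i) (hb i) hreg hβ
  have hcoord := fun i => coord_le hr hs1 hθ hη₀ (h0 i) (h1 i) hm0
    (B := B i) (fun k => integral_nonneg fun ω => sq_nonneg _) (hB0 i) (fun k => by
      have := integral_coord_sq_succ_le hc hM hS hβ (b.orthonormal.1 i) (hb i) k
      rwa [hη] at this) n
  refine integral_norm_sq_le_of_coord b (memLp_sqrtCov_sub (sgd_memLp hS hβ n)) fun J => ?_
  have hg : ∑ i ∈ J, inner ℝ g (b i) ^ 2 ≤ ‖g‖ ^ 2 := by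
    have := b.orthonormal.sum_inner_products_le (s := J) g
    simpa [real_inner_comm] using this
  have hT : ∑ i ∈ J, ev i ^ s ≤ (opTrace (opPow (M.mixedOp K) s)).toReal :=
    sum_rpow_le_opTrace_toReal hpos b hb hs0 htr J
  have hS0 := stepSum_nonneg θ 0 n
  have hsum0 := sum_noise_nonneg θ s hm0 n
  have hs2 : (0 : ℝ) ≤ 2 - s := by linarith
  refine (sum_le_of_le_add (by positivity) (by positivity) hcoord hg hT).trans (le_of_eq ?_)
  ring

/-- With `m = min(2r, 2-s)`, `θ = m / (1 + m)` solves `θ = (1 - θ) m`; hence neither the bias nor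
the early noise decays more slowly than `n^{-θ}`. -/
lemma rateExponent_spec {r s : ℝ} (hr : 0 < r) (hs1 : s ≤ 1) :
    0 < rateExponent r s ∧ rateExponent r s < 1 ∧
      rateExponent r s ≤ (1 - rateExponent r s) * (2 * r) ∧
      rateExponent r s ≤ (1 - rateExponent r s) * (2 - s) := by
  have hm : 0 < min (2 * r) (2 - s) := lt_min (by linarith) (by linarith)
  have h1 := min_le_left (2 * r) (2 - s)
  have h2 := min_le_right (2 * r) (2 - s)
  rw [rateExponent]
  set m := min (2 * r) (2 - s)
  have e : 1 - m / (1 + m) = 1 / (1 + m) := by field_simp; ring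
  refine ⟨by positivity, by rw [div_lt_one (by positivity)]; linarith, ?_, ?_⟩ <;>
  · rw [e, div_mul_eq_mul_div, one_mul]
    gcongr

end Assembly

end FunctionalRegression

theorem theorem1 (r s c κ τ : ℝ) (hr : 0 < r) (hs0 : 0 < s) (hs1 : s ≤ 1) (hc : 0 < c) :
    (2 * r ≤ 2 - s → rateExponent r s = 2 * r / (2 * r + 1)) ∧
    (2 - s ≤ 2 * r → rateExponent r s = (2 - s) / (3 - s)) ∧
    ∃ C₁S : ℝ, 0 < C₁S ∧
      ∀ η₀ : ℝ, 0 < η₀ → η₀ ≤ min 1 (min (κ ^ 2)⁻¹ C₁S) →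
      ∀ v b γ : ℝ, ∃ C₁ : ℝ, 0 < C₁ ∧
        ∀ (d : ℕ) (Ω : Type*) [MeasurableSpace Ω] (P : Measure Ω) [IsProbabilityMeasure P]
          (Ω' : Type*) [MeasurableSpace Ω'] (P' : Measure Ω') [IsProbabilityMeasure P']
          (M : FunctionalLinearModel d P) (K : ReproducingKernel d) (g : L2 d)
          (x : ℕ → Ω' → L2 d) (y : ℕ → Ω' → ℝ),
          K.kappa = κ →
          opTrace (opPow (M.mixedOp K) s) < ⊤ → (opTrace (opPow (M.mixedOp K) s)).toReal = τ →
          M.MomentCondition c →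
          M.Regularity K r g →
          Var[M.noise; P] = v → ‖M.slope‖ = b → ‖g‖ = γ →
          M.IsSample P' x y →
          ∀ (η : ℕ → ℝ) (βhat : ℕ → Ω' → L2 d),
            (∀ t : ℕ, 1 ≤ t → η t = η₀ * (t : ℝ) ^ (-rateExponent r s)) →
            (∀ (t : ℕ) (ω : Ω'), βhat t ω = sgd K η (fun k => x k ω) (fun k => y k ω) t) →
            ∀ t : ℕ, 1 ≤ t →
              Integrable
                (fun ω => M.excessError fun f => inner ℝ (βhat (t + 1) ω) f) P' ∧
              ∫ ω, M.excessError (fun f => inner ℝ (βhat (t + 1) ω) f) ∂P' ≤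
                C₁ * (if s < 1 then ((t : ℝ) + 1) ^ (-rateExponent r s)
                  else ((t : ℝ) + 1) ^ (-rateExponent r s) * Real.log ((t : ℝ) + 1)) := by
  refine ⟨fun h => by rw [rateExponent, min_eq_left h, add_comm],
    fun h => by rw [rateExponent, min_eq_right h]; congr 1; ring, ?_⟩
  obtain ⟨hθ0, hθ1, hθr, hθs⟩ := rateExponent_spec hr hs1
  set θ := rateExponent r s
  obtain ⟨D, hD0, hD⟩ := exists_noiseWeight_le hθ0 hθ1 hs1 hθs
  set W := D * (1 + θ⁻¹) with hWdef
  have hW0 : 0 ≤ W := by positivity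
  have hW : ∀ n, noiseWeight θ (2 - s) n ≤ W := fun n => by
    rcases Nat.eq_zero_or_pos n with rfl | hn
    · simpa [noiseWeight] using hW0
    · exact (hD n hn).trans (mul_le_mul_of_nonneg_left (rate_le hθ0 n) hD0)
  have hs2 : (0 : ℝ) ≤ 2 - s := by linarith
  set q := Real.exp 2 * (2 - s) ^ (2 - s) with hq
  have hq0 : 0 ≤ q := by positivity
  -- Chosen so that `η₀ ^ s q τ c W ≤ 1/2`. At this point `τ` is an arbitrary real, hence the
  -- absolute value; the `+ 1` keeps the denominator positive.
  refine ⟨((2 * (q * |τ| * c * W) + 1)⁻¹) ^ (1 / s), by positivity, ?_⟩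
  intro η₀ hη₀ hη₀le v b γ
  have hηκ : η₀ ≤ (κ ^ 2)⁻¹ := hη₀le.trans ((min_le_right _ _).trans (min_le_left _ _))
  have hηC := hη₀le.trans ((min_le_right _ _).trans (min_le_right _ _))
  have hηs : η₀ ^ s ≤ (2 * (q * |τ| * c * W) + 1)⁻¹ := by
    have h1 := Real.rpow_le_rpow hη₀.le hηC hs0.le
    rwa [← Real.rpow_mul (by positivity), one_div_mul_cancel hs0.ne', Real.rpow_one] at h1
  set A := Real.exp 2 * (2 * r) ^ (2 * r) * η₀ ^ (-(2 * r)) * γ ^ 2 with hA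
  set Q := q * η₀ ^ s * τ with hQ
  -- The maximum with `1` secures positivity before `v` and `τ` are known to be nonnegative.
  refine ⟨max 1 (A * (2 * (Real.log 2)⁻¹) + Q * (c * (2 * (A + Q * v * W)) + v) * D),
    by positivity, ?_⟩
  intro d Ω _ P _ Ω' _ P' _ M K g x y hκ htr hτ hM hreg hv _ hγ hS η β hη hβ t ht
  have hηκ' : η₀ * K.kappa ^ 2 ≤ 1 := by
    rw [hκ]
    -- The bound `(κ²)⁻¹ κ² ≤ 1` needs no case distinction, the inverse of `0` being `0`.
    exact (mul_le_mul_of_nonneg_right hηκ (sq_nonneg _)).trans (inv_mul_le_one)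
  have hη' : ∀ n, η (n + 1) = η₀ * stepSeq θ n := fun n => by
    rw [hη (n + 1) (Nat.le_add_left 1 n), stepSeq]
    push_cast
    rfl
  have hA0 : 0 ≤ A := by positivity
  have hτ0 : 0 ≤ τ := hτ ▸ ENNReal.toReal_nonneg
  have hv0 : 0 ≤ v := hv ▸ variance_nonneg _ _
  have hQ0 : 0 ≤ Q := by positivity
  have hQW : Q * c * W ≤ 1 / 2 := by
    rw [abs_of_nonneg hτ0] at hηs
    have h1 := mul_le_mul_of_nonneg_right hηs (by positivity : 0 ≤ q * τ * c * W)
    have h2 : (2 * (q * τ * c * W) + 1)⁻¹ * (q * τ * c * W) ≤ 1 / 2 := by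
      rw [inv_mul_eq_div, div_le_iff₀ (by positivity)]
      linarith
    calc _ = η₀ ^ s * (q * τ * c * W) := by rw [hQ]; ring
      _ ≤ _ := h1.trans h2
  have hmain := le_of_weak_feedback (p := 2 * r) (by positivity) hA0 hQ0 hc.le hv0 hW hQW
    (a := fun n => ∫ ω, ‖M.sqrtCov (β (n + 1) ω - M.slope)‖ ^ 2 ∂P')
    (fun n => by
      have := integral_norm_sq_le hr hs0 hs1 hc.le hθ0.le hη₀ hηκ' htr hM hreg hS hη' hβ n
      rwa [hτ, hv, hγ] at this) t
  simp only [M.excessError_inner]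
  refine ⟨(memLp_sqrtCov_sub (sgd_memLp hS hβ t)).integrable_norm_pow (by norm_num), ?_⟩
  change _ ≤ _ * rate θ s t
  refine hmain.trans ?_
  have hr0 := rate_nonneg θ s t
  calc _ ≤ A * (2 * (Real.log 2)⁻¹ * rate θ s t) +
        Q * (c * (2 * (A + Q * v * W)) + v) * (D * rate θ s t) := by
        gcongr
        · exact one_add_stepSum_rpow_le_rate hθ0 hθ1 (by positivity) hθr ht
        · exact hD t ht
    _ = (A * (2 * (Real.log 2)⁻¹) + Q * (c * (2 * (A + Q * v * W)) + v) * D) * rate θ s t := by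
        ring
    _ ≤ _ := by
        gcongr
        exact le_max_right _ _
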